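/- **Setting.** Let $\mathbb{B}$ be a locally cartesian closed category with finite limits and let $q : \mathbb{E} \to \mathbb{B}$ be a Grothendieck fibration; $\mathbb{E}_I$ denotes the fibre over $I$, and a map of $\mathbb{E}$ is vertical if it lies over an identity. Assume that $q$ is locally small: for $A, X \in \mathbb{E}_I$ the presheaf $(\sigma : K \to I) \mapsto \mathbb{E}_K(\sigma^*A, \sigma^*X)$ on $\mathbb{B}/I$ is representable. Then for $A \in \mathbb{E}_I$ and $X \in \mathbb{E}_J$ there is a hom object $\hom(A,X) \to I \times J$ representing $(\sigma,\tau) \mapsto \mathbb{E}_K(\sigma^*A, \tau^*X)$. Let $V(\mathbb{E})$ be the category of vertical maps and commutative squares, and assume that $\operatorname{cod} : V(\mathbb{E}) \to \mathbb{E}$ is a Grothendieck fibration (equivalently, the fibres $\mathbb{E}_I$ have pullbacks and reindexing preserves them). **Definitions.** For a fibration $p$, $\operatorname{Cart}(p)$ is the category of objects of the total category of $p$ and $p$-cartesian maps. A *notion of structure* on a fibration $p : \mathbb{C} \to \mathbb{A}$ is a functor $\chi : \mathbb{D} \to \mathbb{C}$ such that $p\chi$ is a fibration, $\chi$ preserves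 cartesian maps, and the restriction $\operatorname{Cart}(\chi) : \operatorname{Cart}(p\chi) \to \operatorname{Cart}(p)$ is a discrete fibration. It is *definable* if $\operatorname{Cart}(\chi)$ has a right adjoint. For a vertical map $m : A \to B$ over $I$ and a vertical map $f : X \to Y$ put $\hom(m,f) := \hom(A,X) \times_{\hom(A,Y)} \hom(B,Y)$. The *lifting notion of structure generated by $m$* is the forgetful functor $m^{\pitchfork} \to V(\mathbb{E})$, over $\operatorname{cod} : V(\mathbb{E}) \to \mathbb{E}$, where an object of $m^{\pitchfork}$ is a vertical map $f : X \to Y$ with a section of the canonical map $t_f : \hom(B,X) \to \hom(m,f)$, and a morphism is a commutative square which is compatible with the sections. Restricting to the fibres over $J \in \mathbb{B}$ gives a functor $\chi_J : (m^{\pitchfork})_J \to \mathbb{E}_J^{\to}$ over $\operatorname{cod} : \mathbb{E}_J^{\to} \to \mathbb{E}_J$. An object $B \in \mathbb{E}_I$ is *tiny relative to $J$* if the functor $\hom(B,-) : \mathbb{E}_J \to \mathbb{B}/(I \times J)$ has a right adjoint. **Theorem.** Let $m : A \to B$ be a vertical map in $\mathbb{E}_I$, where $B$ is tiny relative to $J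 \in \mathbb{B}$. Then $\chi_J$ is a definable notion of structure on $\operatorname{cod} : \mathbb{E}_J^{\to} \to \mathbb{E}_J$. Moreover, let $G$ be any right adjoint of $\hom(B,-) : \mathbb{E}_J \to \mathbb{B}/(I\times J)$, with unit $\eta$, let $R$ be any right adjoint of $\operatorname{Cart}(\chi_J)$, let $f : X \to Y$ be a map of $\mathbb{E}_J$, and let $\prod_{p} t_f : \prod_p \hom(B,X) \to \hom(B,Y)$ be the dependent product of $t_f$ along the projection $p : \hom(m,f) \to \hom(B,Y)$, viewed as a map of $\mathbb{B}/(I \times J)$. Then the codomain component $\operatorname{cod}(\chi_J R f) \to Y$ of the counit at $f$ is a pullback, in $\mathbb{E}_J$, of $G(\prod_p t_f) : G(\prod_p \hom(B,X)) \to G(\hom(B,Y))$ along $\eta_Y : Y \to G(\hom(B,Y))$. -/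

import Mathlib

open CategoryTheory CategoryTheory.Limits CategoryTheory.Functor Opposite

universe v₁ u₁ v₂ u₂ v₃ u₃

/-! ### Fibrations, cartesian maps and notions of structure -/

namespace FibStr

section Structures

variable {𝒮 : Type u₁} [Category.{v₁} 𝒮] {𝒞 : Type u₂} [Category.{v₂} 𝒞]
  {𝒟 : Type u₃} [Category.{v₃} 𝒟]

/-- The class of `p`-cartesian maps in the total category of `p`. -/
def cartesian (p : 𝒞 ⥤ 𝒮) : MorphismProperty 𝒞 :=
  fun _ _ φ => p.IsStronglyCartesian (p.map φ) φ

instance (p : 𝒞 ⥤ 𝒮) : (cartesian p).IsMultiplicative where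
  id_mem X := by
    change p.IsStronglyCartesian (p.map (𝟙 X)) (𝟙 X)
    infer_instance
  comp_mem f g hf hg := by
    have : p.IsStronglyCartesian (p.map f) f := hf
    have : p.IsStronglyCartesian (p.map g) g := hg
    change p.IsStronglyCartesian (p.map (f ≫ g)) (f ≫ g)
    rw [p.map_comp]
    infer_instance

/-- `Cart(p)`: the wide subcategory of the total category on the cartesian maps. -/
abbrev Cart (p : 𝒞 ⥤ 𝒮) := WideSubcategory (cartesian p)

/-- A functor `F` is a discrete fibration: every map `e ⟶ F d` has exactly one lift with
codomain `d`, that is, for every `d` the functor `𝒟 / d ⥤ 𝒞 / F d` is bijective on objects. -/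
def IsDiscreteFibration (F : 𝒟 ⥤ 𝒞) : Prop :=
  ∀ d : 𝒟, Function.Bijective (Over.post (X := d) F).obj

/-- The functor `χ`, from the fibration `χ ⋙ q` to the fibration `q`, preserves cartesian maps. -/
def PreservesCartesian (χ : 𝒟 ⥤ 𝒞) (q : 𝒞 ⥤ 𝒮) : Prop :=
  ∀ ⦃d d' : 𝒟⦄ (φ : d ⟶ d'), cartesian (χ ⋙ q) φ → cartesian q (χ.map φ)

/-- `Cart(χ) : Cart(χ ⋙ q) ⥤ Cart(q)`, the restriction of a fibred functor to cartesian maps. -/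
def cartMap (χ : 𝒟 ⥤ 𝒞) (q : 𝒞 ⥤ 𝒮) (h : PreservesCartesian χ q) :
    Cart (χ ⋙ q) ⥤ Cart q where
  obj d := ⟨χ.obj d.obj⟩
  map φ := ⟨χ.map φ.hom, h _ φ.property⟩
  map_id d := WideSubcategory.hom_ext _ (χ.map_id d.obj)
  map_comp φ ψ := WideSubcategory.hom_ext _ (χ.map_comp φ.hom ψ.hom)

/-- `χ : 𝒟 ⥤ 𝒞` is a (fibred) notion of structure on the Grothendieck fibration `q : 𝒞 ⥤ 𝒮`:
`χ ⋙ q` is a fibration as well, `χ` is a fibred functor, and `χ` creates cartesian lifts. -/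
structure IsNotionOfStructure (χ : 𝒟 ⥤ 𝒞) (q : 𝒞 ⥤ 𝒮) : Prop where
  base_isFibered : q.IsFibered
  total_isFibered : (χ ⋙ q).IsFibered
  preservesCartesian : PreservesCartesian χ q
  isDiscreteFibration : IsDiscreteFibration (cartMap χ q preservesCartesian)

/-- A notion of structure `χ` is definable if `Cart(χ)` has a right adjoint. -/
def IsNotionOfStructure.IsDefinable {χ : 𝒟 ⥤ 𝒞} {q : 𝒞 ⥤ 𝒮}
    (h : IsNotionOfStructure χ q) : Prop :=
  (cartMap χ q h.preservesCartesian).IsLeftAdjoint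

/-- The restriction of a functor `F` over `𝒮` to the fibre categories over `J`. -/
def fiberMap (F : 𝒟 ⥤ 𝒞) (p : 𝒞 ⥤ 𝒮) (J : 𝒮) : (F ⋙ p).Fiber J ⥤ p.Fiber J :=
  Fiber.inducedFunctor (F := Fiber.fiberInclusion ⋙ F)
    (Fiber.fiberInclusion_comp_eq_const (p := F ⋙ p) (S := J))

/-- A category with pullbacks is locally cartesian closed if all pullback functors between slice
categories have right adjoints (dependent products). -/
class LocallyCartesianClosed (𝒮 : Type u₁) [Category.{v₁} 𝒮] [HasPullbacks 𝒮] : Prop where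
  isLeftAdjoint_pullback {X Y : 𝒮} (f : X ⟶ Y) : (Over.pullback f).IsLeftAdjoint

attribute [instance] LocallyCartesianClosed.isLeftAdjoint_pullback

end Structures

/-! ### Reindexing and locally small fibrations -/

lemma fiber_obj {𝒮 : Type u₁} [Category.{v₁} 𝒮] {𝒳 : Type u₂} [Category.{v₂} 𝒳] {q : 𝒳 ⥤ 𝒮}
    {J : 𝒮} (X : q.Fiber J) : q.obj (Fiber.fiberInclusion.obj X) = J := X.2

section Reindexing

variable {𝒮 : Type u₁} [Category.{v₁} 𝒮] {𝒳 : Type u₂} [Category.{v₂} 𝒳]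
  {q : 𝒳 ⥤ 𝒮} [q.IsFibered] {I : 𝒮}

/-- For `A` in the fibre over `I`, the functor sending `σ : K ⟶ I` to (a choice of) the
reindexing `σ^* A`. -/
noncomputable def reindex {A : 𝒳} (hA : q.obj A = I) : Over I ⥤ 𝒳 where
  obj K := IsPreFibered.pullbackObj hA K.hom
  map {K L} t :=
    IsStronglyCartesian.map q L.hom (IsPreFibered.pullbackMap hA L.hom) (Over.w t).symm
      (IsPreFibered.pullbackMap hA K.hom)
  map_id K := by
    symm
    have h : q.IsHomLift (𝟙 K : K ⟶ K).left (𝟙 (IsPreFibered.pullbackObj hA K.hom)) :=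
      IsHomLift.id (IsPreFibered.pullbackObj_proj hA K.hom)
    apply IsStronglyCartesian.map_uniq
    simp
  map_comp {K L M} s t := by
    symm
    have h : q.IsHomLift (s ≫ t).left
        (IsStronglyCartesian.map q L.hom (IsPreFibered.pullbackMap hA L.hom) (Over.w s).symm
            (IsPreFibered.pullbackMap hA K.hom) ≫
          IsStronglyCartesian.map q M.hom (IsPreFibered.pullbackMap hA M.hom) (Over.w t).symm
            (IsPreFibered.pullbackMap hA L.hom)) := by
      rw [Over.comp_left]
      infer_instance
    apply IsStronglyCartesian.map_uniq
    simp

/-- The chosen cartesian map `σ^* A ⟶ A` over `σ : K ⟶ I`. -/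
noncomputable def reindexProj {A : 𝒳} (hA : q.obj A = I) (K : Over I) :
    (reindex hA).obj K ⟶ A :=
  IsPreFibered.pullbackMap hA K.hom

instance reindexProj_isCartesian {A : 𝒳} (hA : q.obj A = I) (K : Over I) :
    q.IsCartesian K.hom (reindexProj hA K) :=
  IsPreFibered.pullbackMap.IsCartesian hA K.hom

lemma reindex_map_proj {A : 𝒳} (hA : q.obj A = I) {K L : Over I} (t : K ⟶ L) :
    (reindex hA).map t ≫ reindexProj hA L = reindexProj hA K :=
  IsStronglyCartesian.fac q L.hom (IsPreFibered.pullbackMap hA L.hom) (Over.w t).symm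
    (IsPreFibered.pullbackMap hA K.hom)

instance reindex_map_isHomLift {A : 𝒳} (hA : q.obj A = I) {K L : Over I} (t : K ⟶ L) :
    q.IsHomLift t.left ((reindex hA).map t) :=
  IsStronglyCartesian.map_isHomLift q L.hom (IsPreFibered.pullbackMap hA L.hom) (Over.w t).symm
    (IsPreFibered.pullbackMap hA K.hom)

lemma reindex_obj_proj {A : 𝒳} (hA : q.obj A = I) (K : Over I) :
    q.obj ((reindex hA).obj K) = K.left :=
  IsPreFibered.pullbackObj_proj hA K.hom

/-- For a vertical map `m : A ⟶ B` over `I` and `σ : K ⟶ I`, the vertical map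
`σ^* m : σ^* A ⟶ σ^* B`. -/
noncomputable def reindexMap {A B : 𝒳} (hA : q.obj A = I) (hB : q.obj B = I) (m : A ⟶ B)
    [q.IsHomLift (𝟙 I) m] (K : Over I) : (reindex hA).obj K ⟶ (reindex hB).obj K :=
  IsCartesian.map q K.hom (reindexProj hB K) (reindexProj hA K ≫ m)

lemma reindexMap_naturality {A B : 𝒳} (hA : q.obj A = I) (hB : q.obj B = I) (m : A ⟶ B)
    [q.IsHomLift (𝟙 I) m] {K L : Over I} (t : K ⟶ L) :
    (reindex hA).map t ≫ reindexMap hA hB m L = reindexMap hA hB m K ≫ (reindex hB).map t := by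
  have h1 : q.IsHomLift (𝟙 K.left) (reindexMap hA hB m K) := IsCartesian.map_isHomLift q K.hom _ _
  have h2 : q.IsHomLift (𝟙 L.left) (reindexMap hA hB m L) := IsCartesian.map_isHomLift q L.hom _ _
  have h (K : Over I) : reindexMap hA hB m K ≫ reindexProj hB K = reindexProj hA K ≫ m :=
    IsCartesian.fac q K.hom _ _
  apply IsStronglyCartesian.ext q L.hom (reindexProj hB L) t.left
  rw [Category.assoc, h, Category.assoc, reindex_map_proj, h, ← Category.assoc, reindex_map_proj]

/-- For `A`, `X` in the fibre over `I`, the presheaf on `𝒮 / I` of maps `σ^* A ⟶ X` over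
`σ : K ⟶ I`, equivalently of vertical maps `σ^* A ⟶ σ^* X` over `K`. -/
noncomputable def fibreHom {A X : 𝒳} (hA : q.obj A = I) (_hX : q.obj X = I) :
    (Over I)ᵒᵖ ⥤ Type v₂ where
  obj K := {φ : (reindex hA).obj K.unop ⟶ X // q.IsHomLift K.unop.hom φ}
  map {K L} t := TypeCat.ofHom fun φ => ⟨(reindex hA).map t.unop ≫ φ.1, by
    have := φ.2
    rw [← Over.w t.unop]
    infer_instance⟩

variable (q) in
/-- The fibration `q` is locally small: for all objects `A`, `X` of the same fibre, the presheaf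
of vertical maps from reindexings of `A` to reindexings of `X` is representable. -/
class LocallySmallFibration : Prop where
  isRepresentable {I : 𝒮} {A X : 𝒳} (hA : q.obj A = I) (hX : q.obj X = I) :
    (fibreHom hA hX).IsRepresentable

/-- For `A` over `I` and `X` in an arbitrary fibre, the presheaf on `𝒮 / I` of maps `σ^* A ⟶ X`.
Such a map lies over a unique `τ : K ⟶ q X`, so that it amounts to a map `(σ, τ)` from `K` to
`I × q X` together with a vertical map `σ^* A ⟶ τ^* X`. -/
noncomputable abbrev homPresheaf {A : 𝒳} (hA : q.obj A = I) (X : 𝒳) : (Over I)ᵒᵖ ⥤ Type v₂ :=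
  (reindex hA).op ⋙ yoneda.obj X

/-- In a locally small fibration over a base with binary products the hom objects `hom(A, X)` exist
for `A` and `X` in different fibres: `hom(π₀^* A, π₁^* X)` over `I × q X` is one. -/
instance homPresheaf_isRepresentable [LocallySmallFibration q] [HasBinaryProducts 𝒮]
    {A : 𝒳} (hA : q.obj A = I) (X : 𝒳) : (homPresheaf hA X).IsRepresentable := by
  obtain ⟨J, hJ⟩ : ∃ J, q.obj X = J := ⟨_, rfl⟩
  obtain ⟨A', a, ha⟩ := IsPreFibered.exists_isCartesian q hA (prod.fst : I ⨯ J ⟶ I)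
  obtain ⟨X', x, hx⟩ := IsPreFibered.exists_isCartesian q hJ (prod.snd : I ⨯ J ⟶ J)
  have hA' := IsHomLift.domain_eq q (prod.fst : I ⨯ J ⟶ I) a
  have hX' := IsHomLift.domain_eq q (prod.snd : I ⨯ J ⟶ J) x
  obtain ⟨H, ⟨r⟩⟩ := LocallySmallFibration.isRepresentable hA' hX'
  obtain ⟨u, hu, hr⟩ : ∃ u : (reindex hA').obj H ⟶ X', q.IsHomLift H.hom u ∧
      ∀ {K : Over (I ⨯ J)} (t : K ⟶ H), (r.homEquiv t).1 = (reindex hA').map t ≫ u := by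
    refine ⟨(r.homEquiv (𝟙 H)).1, (r.homEquiv (𝟙 H)).2, fun {K} t => ?_⟩
    have := r.homEquiv_comp t (𝟙 H)
    rw [Category.comp_id] at this
    rw [this]
    rfl
  -- the comparison of `(fst ∘ ρ)^* A` with `ρ^* fst^* A`
  have hc (K : 𝒮) (k : K ⟶ I) (k' : K ⟶ I ⨯ J) (w : k' ≫ prod.fst = k) :
      ∃ θ : (reindex hA).obj (Over.mk k) ≅ (reindex hA').obj (Over.mk k'),
        q.IsHomLift (𝟙 K) θ.hom ∧
        θ.hom ≫ reindexProj hA' (Over.mk k') ≫ a = reindexProj hA (Over.mk k) := by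
    subst w
    have h1 : q.IsCartesian k' (reindexProj hA' (Over.mk k')) :=
      reindexProj_isCartesian hA' (Over.mk k')
    have h2 : q.IsCartesian (k' ≫ prod.fst) (reindexProj hA (Over.mk (k' ≫ prod.fst))) :=
      reindexProj_isCartesian hA (Over.mk (k' ≫ prod.fst))
    exact ⟨IsCartesian.domainUniqueUpToIso q (k' ≫ prod.fst)
        (reindexProj hA' (Over.mk k') ≫ a) (reindexProj hA (Over.mk (k' ≫ prod.fst))),
      inferInstance,
      IsCartesian.fac q (k' ≫ prod.fst) (reindexProj hA' (Over.mk k') ≫ a) _⟩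
  obtain ⟨H, h, rfl⟩ : ∃ (H' : 𝒮) (h : H' ⟶ I ⨯ J), H = Over.mk h := ⟨H.left, H.hom, rfl⟩
  replace hu : q.IsHomLift h u := hu
  obtain ⟨θ, hθ, hθp⟩ := hc H (h ≫ prod.fst) h rfl
  obtain ⟨w, hw⟩ : ∃ w, w = θ.hom ≫ u ≫ x := ⟨_, rfl⟩
  have key (K : Over I) (φ : (reindex hA).obj K ⟶ X) :
      ∃! t : K ⟶ Over.mk (h ≫ prod.fst), (reindex hA).map t ≫ w = φ := by
    obtain ⟨K, k, rfl⟩ : ∃ (K' : 𝒮) (k : K' ⟶ I), K = Over.mk k := ⟨K.left, K.hom, rfl⟩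
    obtain ⟨b, hb⟩ : ∃ b : K ⟶ J, q.IsHomLift b φ :=
      ⟨eqToHom (reindex_obj_proj hA (Over.mk k)).symm ≫ q.map φ ≫ eqToHom hJ, inferInstance⟩
    obtain ⟨k', hk1, hk2⟩ : ∃ k' : K ⟶ I ⨯ J, k' ≫ prod.fst = k ∧ k' ≫ prod.snd = b :=
      ⟨prod.lift k b, prod.lift_fst _ _, prod.lift_snd _ _⟩
    obtain ⟨ψ, hψ, hψp⟩ := hc K k k' hk1
    have hcomp {t : Over.mk k ⟶ Over.mk (h ≫ prod.fst)} {t0 : Over.mk k' ⟶ Over.mk h}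
        (l : K ⟶ H) (e : t.left = l) (e0 : t0.left = l) :
        (reindex hA).map t ≫ θ.hom = ψ.hom ≫ (reindex hA').map t0 := by
      have e1 : q.IsHomLift l ((reindex hA).map t) := e ▸ reindex_map_isHomLift hA t
      have e2 : q.IsHomLift l ((reindex hA').map t0) := e0 ▸ reindex_map_isHomLift hA' t0
      have e3 : q.IsCartesian h (reindexProj hA' (Over.mk h)) :=
        reindexProj_isCartesian hA' (Over.mk h)
      apply IsStronglyCartesian.ext q (h ≫ prod.fst) (reindexProj hA' (Over.mk h) ≫ a) l
      rw [Category.assoc, hθp, reindex_map_proj, Category.assoc, ← Category.assoc _ _ a,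
        reindex_map_proj, hψp]
    have h3 : q.IsHomLift (k' ≫ prod.snd) (ψ.inv ≫ φ) := by
      rw [hk2]
      infer_instance
    obtain ⟨φ', ⟨hφ1, hφ2⟩, -⟩ := IsStronglyCartesian.universal_property q prod.snd x k'
      (k' ≫ prod.snd) rfl (ψ.inv ≫ φ)
    obtain ⟨t0, ht0⟩ := r.homEquiv.surjective (⟨φ', hφ1⟩ : {φ : (reindex hA').obj (Over.mk k') ⟶ X'
      // q.IsHomLift (Over.mk k').hom φ})
    replace ht0 : (reindex hA').map t0 ≫ u = φ' := by
      rw [← hr, ht0]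
    have hw0 : t0.left ≫ h = k' := Over.w t0
    refine ⟨Over.homMk t0.left ?_, ?_, ?_⟩
    · change t0.left ≫ h ≫ prod.fst = k
      rw [← Category.assoc, hw0, hk1]
    · beta_reduce
      rw [hw, ← Category.assoc, hcomp (t0 := t0) t0.left rfl rfl, Category.assoc,
        ← Category.assoc _ u, ht0, hφ2, Iso.hom_inv_id_assoc]
    · intro t ht
      obtain ⟨l, hl⟩ : ∃ l : K ⟶ H, t.left = l := ⟨_, rfl⟩
      have e1 : q.IsHomLift l ((reindex hA).map t) := hl ▸ reindex_map_isHomLift hA t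
      have hw1 : l ≫ h ≫ prod.fst = k := hl ▸ Over.w t
      have hb' : l ≫ h ≫ prod.snd = b := by
        have h4 : q.IsHomLift (l ≫ h ≫ prod.snd) ((reindex hA).map t ≫ w) := by
          rw [hw]
          infer_instance
        rw [ht] at h4
        rw [IsHomLift.fac q (l ≫ h ≫ prod.snd) φ, IsHomLift.fac q b φ]
      have hlh : l ≫ h = k' := by
        apply Limits.prod.hom_ext
        · rw [Category.assoc, hw1, hk1]
        · rw [Category.assoc, hb', hk2]
      obtain ⟨t1, ht1l⟩ : ∃ t1 : Over.mk k' ⟶ Over.mk h, t1.left = l := ⟨Over.homMk l hlh, rfl⟩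
      have ht1 : (reindex hA').map t1 ≫ u = φ' := by
        have e2 : q.IsHomLift l ((reindex hA').map t1) := ht1l ▸ reindex_map_isHomLift hA' t1
        have h5 : q.IsHomLift k' ((reindex hA').map t1 ≫ u) :=
          hlh ▸ IsHomLift.comp q l h ((reindex hA').map t1) u
        apply IsStronglyCartesian.ext q prod.snd x k'
        rw [hφ2, ← ht, Iso.eq_inv_comp, hw, ← Category.assoc _ θ.hom,
          hcomp (t0 := t1) l hl ht1l]
        simp only [Category.assoc]
      have : t1 = t0 := by
        apply r.homEquiv.injective
        apply Subtype.ext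
        rw [hr, hr, ht1, ht0]
      apply Over.OverMorphism.ext
      rw [hl, ← ht1l, this]
      rfl
  exact ⟨Over.mk (h ≫ prod.fst), ⟨{
    homEquiv := fun {K} => Equiv.ofBijective (fun t => (reindex hA).map t ≫ w)
      ⟨fun s t h => (key K _).unique h rfl, fun φ => (key K φ).exists⟩
    homEquiv_comp := by
      intro K L s t
      change (reindex hA).map (s ≫ t) ≫ w = (reindex hA).map s ≫ (reindex hA).map t ≫ w
      rw [Functor.map_comp, Category.assoc] }⟩⟩

end Reindexing

/-! ### Hom objects -/

section HomObjects

variable {𝒮 : Type u₁} [Category.{v₁} 𝒮] {𝒳 : Type u₂} [Category.{v₂} 𝒳]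
  {q : 𝒳 ⥤ 𝒮} [q.IsFibered] [LocallySmallFibration q] [HasBinaryProducts 𝒮] {I : 𝒮}

/-- The hom object `hom(A, X)`, with its projection to `I = q A`. -/
noncomputable def homObj {A : 𝒳} (hA : q.obj A = I) (X : 𝒳) : Over I :=
  (homPresheaf hA X).reprX

/-- The universal property of `hom(A, X)`: maps `σ ⟶ hom(A, X)` over `I` are maps `σ^* A ⟶ X`. -/
noncomputable def homObjEquiv {A : 𝒳} (hA : q.obj A = I) (X : 𝒳) {K : Over I} :
    (K ⟶ homObj hA X) ≃ ((reindex hA).obj K ⟶ X) :=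
  (homPresheaf hA X).representableBy.homEquiv

lemma homObjEquiv_comp {A : 𝒳} (hA : q.obj A = I) (X : 𝒳) {K L : Over I} (s : K ⟶ L)
    (t : L ⟶ homObj hA X) :
    homObjEquiv hA X (s ≫ t) = (reindex hA).map s ≫ homObjEquiv hA X t :=
  (homPresheaf hA X).representableBy.homEquiv_comp s t

/-- The universal map out of a reindexing of `A` into `X`. -/
noncomputable def homUniv {A : 𝒳} (hA : q.obj A = I) (X : 𝒳) :
    (reindex hA).obj (homObj hA X) ⟶ X :=
  homObjEquiv hA X (𝟙 _)

lemma homObjEquiv_eq {A : 𝒳} (hA : q.obj A = I) (X : 𝒳) {K : Over I} (t : K ⟶ homObj hA X) :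
    homObjEquiv hA X t = (reindex hA).map t ≫ homUniv hA X := by
  rw [homUniv, ← homObjEquiv_comp, Category.comp_id]

/-- Postcomposition with `f : X ⟶ Y`, as a map `hom(A, X) ⟶ hom(A, Y)`. -/
noncomputable def homMap {A : 𝒳} (hA : q.obj A = I) {X Y : 𝒳} (f : X ⟶ Y) :
    homObj hA X ⟶ homObj hA Y :=
  (homObjEquiv hA Y).symm (homUniv hA X ≫ f)

lemma homMap_univ {A : 𝒳} (hA : q.obj A = I) {X Y : 𝒳} (f : X ⟶ Y) :
    (reindex hA).map (homMap hA f) ≫ homUniv hA Y = homUniv hA X ≫ f := by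
  rw [← homObjEquiv_eq, homMap, Equiv.apply_symm_apply]

lemma homMap_id {A : 𝒳} (hA : q.obj A = I) (X : 𝒳) : homMap hA (𝟙 X) = 𝟙 _ := by
  rw [homMap, Equiv.symm_apply_eq, Category.comp_id, homUniv]

lemma homMap_comp {A : 𝒳} (hA : q.obj A = I) {X Y Z : 𝒳} (f : X ⟶ Y) (g : Y ⟶ Z) :
    homMap hA (f ≫ g) = homMap hA f ≫ homMap hA g := by
  rw [homMap, Equiv.symm_apply_eq, homObjEquiv_eq, Functor.map_comp, Category.assoc, homMap_univ,
    ← Category.assoc, ← Category.assoc, homMap_univ]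

/-- For `X` in the fibre over `J`, the projection `hom(A, X) ⟶ J`. -/
noncomputable def homSnd {A : 𝒳} (hA : q.obj A = I) {X : 𝒳} {J : 𝒮} (hX : q.obj X = J) :
    (homObj hA X).left ⟶ J :=
  eqToHom (reindex_obj_proj hA (homObj hA X)).symm ≫ q.map (homUniv hA X) ≫ eqToHom hX

instance homUniv_isHomLift {A : 𝒳} (hA : q.obj A = I) {X : 𝒳} {J : 𝒮} (hX : q.obj X = J) :
    q.IsHomLift (homSnd hA hX) (homUniv hA X) := by
  rw [homSnd]
  infer_instance

lemma homMap_homSnd {A : 𝒳} (hA : q.obj A = I) {J : 𝒮} {X Y : 𝒳} (hX : q.obj X = J)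
    (hY : q.obj Y = J) (f : X ⟶ Y) (hf : q.IsHomLift (𝟙 J) f) :
    (homMap hA f).left ≫ homSnd hA hY = homSnd hA hX := by
  have h1 : q.IsHomLift (homSnd hA hX) (homUniv hA X ≫ f) := inferInstance
  have h2 : q.IsHomLift ((homMap hA f).left ≫ homSnd hA hY) (homUniv hA X ≫ f) := by
    rw [← homMap_univ]
    infer_instance
  exact (IsHomLift.fac q _ (homUniv hA X ≫ f)).trans
    (IsHomLift.fac q (homSnd hA hX) (homUniv hA X ≫ f)).symm

/-- For `B` in the fibre over `I`, the functor `hom(B, -)` from the fibre over `J` to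
`𝒮 / (I × J)`. -/
noncomputable def homFiberFunctor {B : 𝒳} (hB : q.obj B = I) (J : 𝒮) :
    q.Fiber J ⥤ Over (I ⨯ J) where
  obj X := Over.mk
    (prod.lift (homObj hB (Fiber.fiberInclusion.obj X)).hom (homSnd hB (fiber_obj X)))
  map {X Y} f := Over.homMk (homMap hB (Fiber.fiberInclusion.map f)).left (by
    apply Limits.prod.hom_ext
    · rw [Category.assoc]
      simp only [Over.mk_hom, prod.lift_fst]
      exact Over.w _
    · rw [Category.assoc]
      simp only [Over.mk_hom, prod.lift_snd]
      exact homMap_homSnd hB (fiber_obj X) (fiber_obj Y) (Fiber.fiberInclusion.map f) f.2)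
  map_id X := by
    apply Over.OverMorphism.ext
    change (homMap hB (Fiber.fiberInclusion.map (𝟙 X))).left = 𝟙 _
    rw [CategoryTheory.Functor.map_id, homMap_id]
    rfl
  map_comp f g := by
    apply Over.OverMorphism.ext
    change (homMap hB (Fiber.fiberInclusion.map (f ≫ g))).left =
      (homMap hB (Fiber.fiberInclusion.map f)).left ≫ (homMap hB (Fiber.fiberInclusion.map g)).left
    rw [Functor.map_comp, homMap_comp, Over.comp_left]

/-- `B` is tiny relative to `J` if `hom(B, -)`, from the fibre over `J` to `𝒮 / (I × J)`, has a
right adjoint. -/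
def IsTinyRelativeTo {B : 𝒳} (hB : q.obj B = I) (J : 𝒮) : Prop :=
  (homFiberFunctor hB J).IsLeftAdjoint

/-- Precomposition with a vertical map `m : A ⟶ B`, as a map `hom(B, X) ⟶ hom(A, X)`. -/
noncomputable def homPre {A B : 𝒳} (hA : q.obj A = I) (hB : q.obj B = I) (m : A ⟶ B)
    [q.IsHomLift (𝟙 I) m] (X : 𝒳) : homObj hB X ⟶ homObj hA X :=
  (homObjEquiv hA X).symm (reindexMap hA hB m (homObj hB X) ≫ homUniv hB X)

lemma homPre_univ {A B : 𝒳} (hA : q.obj A = I) (hB : q.obj B = I) (m : A ⟶ B)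
    [q.IsHomLift (𝟙 I) m] (X : 𝒳) :
    (reindex hA).map (homPre hA hB m X) ≫ homUniv hA X =
      reindexMap hA hB m (homObj hB X) ≫ homUniv hB X := by
  rw [← homObjEquiv_eq, homPre, Equiv.apply_symm_apply]

lemma homPre_homMap {A B : 𝒳} (hA : q.obj A = I) (hB : q.obj B = I) (m : A ⟶ B)
    [q.IsHomLift (𝟙 I) m] {X Y : 𝒳} (f : X ⟶ Y) :
    homPre hA hB m X ≫ homMap hA f = homMap hB f ≫ homPre hA hB m Y := by
  apply (homObjEquiv hA Y).injective
  rw [homObjEquiv_eq, homObjEquiv_eq, Functor.map_comp, Functor.map_comp, Category.assoc,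
    Category.assoc, homMap_univ, homPre_univ, ← Category.assoc, homPre_univ, Category.assoc,
    ← homMap_univ, ← Category.assoc, ← Category.assoc, reindexMap_naturality]

end HomObjects

/-! ### The lifting notion of structure generated by a vertical map -/

section Lifting

variable {𝒮 : Type u₁} [Category.{v₁} 𝒮] {𝒳 : Type u₂} [Category.{v₂} 𝒳]

/-- `V(q)`: the category of vertical maps, with commutative squares as morphisms. -/
abbrev Vert (q : 𝒳 ⥤ 𝒮) :=
  ObjectProperty.FullSubcategory fun f : Arrow 𝒳 => q.IsHomLift (𝟙 (q.obj f.right)) f.hom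

/-- The codomain functor `V(q) ⥤ 𝒳`. -/
abbrev Vert.cod (q : 𝒳 ⥤ 𝒮) : Vert q ⥤ 𝒳 :=
  ObjectProperty.ι _ ⋙ Arrow.rightFunc

variable {q : 𝒳 ⥤ 𝒮} [q.IsFibered] [LocallySmallFibration q] [HasFiniteLimits 𝒮] {I : 𝒮}
  {A B : 𝒳} (hA : q.obj A = I) (hB : q.obj B = I) (m : A ⟶ B) [q.IsHomLift (𝟙 I) m]

/-- The object `hom(m, f) = hom(A, X) ×_{hom(A, Y)} hom(B, Y)` of lifting problems of `m` against
`f : X ⟶ Y`. -/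
noncomputable def liftingProblems (f : Arrow 𝒳) : 𝒮 :=
  pullback (homMap hA f.hom).left (homPre hA hB m f.right).left

/-- The projection `hom(m, f) ⟶ hom(A, X)`. -/
noncomputable def liftingProblemsFst (f : Arrow 𝒳) :
    liftingProblems hA hB m f ⟶ (homObj hA f.left).left :=
  pullback.fst _ _

/-- The projection `hom(m, f) ⟶ hom(B, Y)`. -/
noncomputable def liftingProblemsSnd (f : Arrow 𝒳) :
    liftingProblems hA hB m f ⟶ (homObj hB f.right).left :=
  pullback.snd _ _

lemma liftingProblems_isPullback (f : Arrow 𝒳) :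
    IsPullback (liftingProblemsFst hA hB m f) (liftingProblemsSnd hA hB m f)
      (homMap hA f.hom).left (homPre hA hB m f.right).left :=
  IsPullback.of_hasPullback _ _

/-- The canonical map `hom(B, X) ⟶ hom(A, X) ×_{hom(A, Y)} hom(B, Y)`. -/
noncomputable def canonicalMap (f : Arrow 𝒳) :
    (homObj hB f.left).left ⟶ liftingProblems hA hB m f :=
  pullback.lift (homPre hA hB m f.left).left (homMap hB f.hom).left (by
    rw [← Over.comp_left, ← Over.comp_left, homPre_homMap])

/-- The map `hom(m, f) ⟶ hom(m, f')` induced by a square from `f` to `f'`. -/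
noncomputable def liftingProblemsMap {f f' : Arrow 𝒳} (φ : f ⟶ f') :
    liftingProblems hA hB m f ⟶ liftingProblems hA hB m f' :=
  pullback.map _ _ _ _ (homMap hA φ.left).left (homMap hB φ.right).left (homMap hA φ.right).left
    (by rw [← Over.comp_left, ← Over.comp_left, ← homMap_comp, ← homMap_comp, Arrow.w])
    (by rw [← Over.comp_left, ← Over.comp_left, homPre_homMap])

lemma liftingProblemsMap_fst {f f' : Arrow 𝒳} (φ : f ⟶ f') :
    liftingProblemsMap hA hB m φ ≫ liftingProblemsFst hA hB m f' =
      liftingProblemsFst hA hB m f ≫ (homMap hA φ.left).left :=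
  pullback.lift_fst _ _ _

lemma liftingProblemsMap_snd {f f' : Arrow 𝒳} (φ : f ⟶ f') :
    liftingProblemsMap hA hB m φ ≫ liftingProblemsSnd hA hB m f' =
      liftingProblemsSnd hA hB m f ≫ (homMap hB φ.right).left :=
  pullback.lift_snd _ _ _

lemma liftingProblemsMap_id (f : Arrow 𝒳) : liftingProblemsMap hA hB m (𝟙 f) = 𝟙 _ := by
  apply (liftingProblems_isPullback hA hB m f).hom_ext
  · rw [liftingProblemsMap_fst, Arrow.id_left, homMap_id, Over.id_left, Category.comp_id,
      Category.id_comp]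
  · rw [liftingProblemsMap_snd, Arrow.id_right, homMap_id, Over.id_left, Category.comp_id,
      Category.id_comp]

lemma liftingProblemsMap_comp {f g h : Arrow 𝒳} (φ : f ⟶ g) (ψ : g ⟶ h) :
    liftingProblemsMap hA hB m (φ ≫ ψ) =
      liftingProblemsMap hA hB m φ ≫ liftingProblemsMap hA hB m ψ := by
  apply (liftingProblems_isPullback hA hB m h).hom_ext
  · rw [liftingProblemsMap_fst, Category.assoc, liftingProblemsMap_fst, ← Category.assoc,
      liftingProblemsMap_fst, Arrow.comp_left, homMap_comp, Over.comp_left, Category.assoc]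
  · rw [liftingProblemsMap_snd, Category.assoc, liftingProblemsMap_snd, ← Category.assoc,
      liftingProblemsMap_snd, Arrow.comp_right, homMap_comp, Over.comp_left, Category.assoc]

/-- An object of `m^⋔`: a vertical map with a section of the canonical map. -/
structure LiftingStructure where
  /-- The underlying vertical map. -/
  vert : Vert q
  /-- The section. -/
  sec : liftingProblems hA hB m vert.obj ⟶ (homObj hB vert.obj.left).left
  isSection : sec ≫ canonicalMap hA hB m vert.obj = 𝟙 _

/-- A morphism of `m^⋔`: a square which commutes with the sections. -/
@[ext]
structure LiftingStructure.Hom (d d' : LiftingStructure hA hB m) where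
  /-- The underlying square. -/
  square : d.vert ⟶ d'.vert
  comm : d.sec ≫ (homMap hB square.hom.left).left =
    liftingProblemsMap hA hB m square.hom ≫ d'.sec

/-- The category `m^⋔`. -/
noncomputable instance : Category (LiftingStructure hA hB m) where
  Hom d d' := LiftingStructure.Hom hA hB m d d'
  id d := ⟨𝟙 _, by
    change d.sec ≫ (homMap hB (𝟙 d.vert.obj.left)).left =
      liftingProblemsMap hA hB m (𝟙 d.vert.obj) ≫ d.sec
    rw [homMap_id, liftingProblemsMap_id, Category.id_comp, Over.id_left, Category.comp_id]⟩
  comp {d d' d''} φ ψ := ⟨φ.square ≫ ψ.square, by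
    change d.sec ≫ (homMap hB (φ.square.hom.left ≫ ψ.square.hom.left)).left =
      liftingProblemsMap hA hB m (φ.square.hom ≫ ψ.square.hom) ≫ d''.sec
    rw [homMap_comp, Over.comp_left, liftingProblemsMap_comp, Category.assoc, ← ψ.comm,
      ← Category.assoc, φ.comm, Category.assoc]⟩
  id_comp φ := LiftingStructure.Hom.ext (Category.id_comp φ.square)
  comp_id φ := LiftingStructure.Hom.ext (Category.comp_id φ.square)
  assoc φ ψ χ := LiftingStructure.Hom.ext (Category.assoc φ.square ψ.square χ.square)

/-- The forgetful functor `m^⋔ ⥤ V(q)`: the lifting notion of structure generated by `m`, on the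
fibration `cod : V(q) ⥤ 𝒳`. -/
noncomputable def liftingNotion : LiftingStructure hA hB m ⥤ Vert q where
  obj d := d.vert
  map φ := φ.square

/-- The codomain functor of the fibre over `J`: the fibre of `V(q)` over `J` is the category of
arrows of the fibre of `q` over `J`. -/
abbrev codAt (q : 𝒳 ⥤ 𝒮) (J : 𝒮) : (Vert.cod q ⋙ q).Fiber J ⥤ q.Fiber J :=
  fiberMap (Vert.cod q) q J

/-- The restriction to the fibres over `J` of the lifting notion of structure generated by `m`. -/
noncomputable abbrev liftingNotionAt (J : 𝒮) :
    (liftingNotion hA hB m ⋙ Vert.cod q ⋙ q).Fiber J ⥤ (Vert.cod q ⋙ q).Fiber J :=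
  fiberMap (liftingNotion hA hB m) (Vert.cod q ⋙ q) J

section Representing

variable [LocallyCartesianClosed 𝒮] {J : 𝒮} (f : (Vert.cod q ⋙ q).Fiber J)

/-- The underlying map in the total category of an object of the fibre of `V(q)` over `J`. -/
abbrev arrowOf : Arrow 𝒳 := (Fiber.fiberInclusion.obj f).obj

/-- The dependent product `∏_p t` over `hom(B, Y)`, of the canonical map
`t : hom(B, X) ⟶ hom(m, f)` along the projection `p : hom(m, f) ⟶ hom(B, Y)`. -/
noncomputable def depProd : Over (homObj hB (arrowOf f).right).left :=
  (Over.pullback (liftingProblemsSnd hA hB m (arrowOf f))).rightAdjoint.obj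
    (Over.mk (canonicalMap hA hB m (arrowOf f)))

/-- The map `∏_p hom(B, X) ⟶ hom(B, Y)`, viewed as a map of `𝒮 / (I × J)`. -/
noncomputable def depProdMap :
    (Over.map ((homFiberFunctor hB J).obj ((codAt q J).obj f)).hom).obj (depProd hA hB m f) ⟶
      (homFiberFunctor hB J).obj ((codAt q J).obj f) :=
  Over.homMk (depProd hA hB m f).hom

end Representing

end Lifting

end FibStr

open FibStr

/-! In the fibre over `J`, cartesian maps for `cod` are pullback squares (`cartesian_codAt_iff`).
Definability therefore asks, for each `f : X ⟶ Y`, for a universal pullback of `f` carrying a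
lifting structure, that is, a terminal object among such pullbacks.

Let `g : Y' ⟶ Y`. Since `hom(A, -)` and `hom(B, -)` preserve pullbacks, `hom(m, g^* f)` is the
pullback of `hom(m, f)` along `hom(B, g)`, and the canonical map of `g^* f` is a pullback of `t_f`
(`liftingProblemsMap_isPullback`, `canonicalMap_isPullback`). A section for `g^* f` is therefore the
same as a lift of `hom(m, g^* f) ⟶ hom(m, f)` through `t_f`. By the dependent product along `p` this
is a map `hom(B, Y') ⟶ ∏_p hom(B, X)` over `hom(B, Y)` (`exists_depProd_eval`). Tininess of `B`
turns that into a map `k : Y' ⟶ G(∏_p hom(B, X))` whose composite with `G(∏_p t_f)` is `η_Y ∘ g`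
(`comp_eq_iff_transpose_comp_eq`). Such pairs `(g, k)` are represented by the pullback of `G(∏_p
t_f)` along `η_Y`.

Compatibility of a square with sections translates to compatibility with the maps `k`, so the
pullback of `f` to this object is universal (`exists_universal_structure`). For an arbitrary right
adjoint `R` the counit at `f` is also terminal, hence isomorphic to this one, and the pullback
description transfers. -/

namespace FibStr

/-! ### Dependent products in the base. -/

section DependentProducts

variable {𝒮 : Type u₁} [Category.{v₁} 𝒮] [HasPullbacks 𝒮] [LocallyCartesianClosed 𝒮]

/-- The universal property of the dependent product of `t` along `p`, for an arbitrary choice of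
pullbacks along `p`. -/
lemma exists_depProd_eval {P Q T : 𝒮} (p : P ⟶ Q) (t : T ⟶ P) (D : Over Q)
    (hD : D = (Over.pullback p).rightAdjoint.obj (Over.mk t)) :
    ∃ ev : pullback D.hom p ⟶ T, ev ≫ t = pullback.snd D.hom p ∧
      ∀ ⦃Z W : 𝒮⦄ (u : Z ⟶ Q) (a : W ⟶ P) (b : W ⟶ Z), IsPullback a b p u →
        ∀ s : W ⟶ T, s ≫ t = a → ∃! r : Z ⟶ D.left, r ≫ D.hom = u ∧
          ∀ l : W ⟶ pullback D.hom p, l ≫ pullback.fst _ _ = b ≫ r → l ≫ pullback.snd _ _ = a →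
            l ≫ ev = s := by
  subst hD
  let adj := Adjunction.ofIsLeftAdjoint (Over.pullback p)
  let ev := adj.counit.app (Over.mk t)
  refine ⟨ev.left, Over.w ev, fun Z W u a b h s hs => ?_⟩
  let e : W ≅ pullback u p := h.flip.isoPullback
  have e1 : e.hom ≫ pullback.fst u p = b := h.flip.isoPullback_hom_fst
  have e2 : e.hom ≫ pullback.snd u p = a := h.flip.isoPullback_hom_snd
  let σ : (Over.pullback p).obj (Over.mk u) ⟶ Over.mk t :=
    Over.homMk (e.inv ≫ s) (by
      change (e.inv ≫ s) ≫ t = pullback.snd u p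
      rw [Category.assoc, hs, ← e2, Iso.inv_hom_id_assoc])
  -- The two projections determine `l`, and such an `l` exists. The quantified condition therefore
  -- says exactly that the adjoint transpose of `r` is `σ`, for any chosen pullback.
  have key (r : Over.mk u ⟶ (Over.pullback p).rightAdjoint.obj (Over.mk t)) :
      (∀ l : W ⟶ pullback ((Over.pullback p).rightAdjoint.obj (Over.mk t)).hom p,
        l ≫ pullback.fst _ _ = b ≫ r.left → l ≫ pullback.snd _ _ = a →
          l ≫ ev.left = s) ↔ (adj.homEquiv _ _).symm r = σ := by
    have h1 : (e.hom ≫ ((Over.pullback p).map r).left) ≫ pullback.fst _ _ = b ≫ r.left := by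
      rw [← e1, Category.assoc, Category.assoc]
      congr 1
      exact pullback.lift_fst _ _ _
    have h2 : (e.hom ≫ ((Over.pullback p).map r).left) ≫ pullback.snd _ _ = a := by
      rw [← e2, Category.assoc]
      congr 1
      exact pullback.lift_snd _ _ _
    rw [Adjunction.homEquiv_counit]
    constructor
    · intro H
      apply Over.OverMorphism.ext
      have := H _ h1 h2
      change ((Over.pullback p).map r).left ≫ ev.left = e.inv ≫ s
      rw [← this, Category.assoc, Iso.inv_hom_id_assoc]
    · intro H l hl1 hl2
      have hl : l = e.hom ≫ ((Over.pullback p).map r).left :=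
        pullback.hom_ext (hl1.trans h1.symm) (hl2.trans h2.symm)
      have H' : ((Over.pullback p).map r).left ≫ ev.left = e.inv ≫ s :=
        congrArg CommaMorphism.left H
      rw [hl, Category.assoc, H', Iso.hom_inv_id_assoc]
  refine ⟨(adj.homEquiv _ _ σ).left, ⟨Over.w (adj.homEquiv _ _ σ), ?_⟩, ?_⟩
  · exact (key (adj.homEquiv _ _ σ)).2 (Equiv.symm_apply_apply _ _)
  · rintro r ⟨hr1, hr2⟩
    have := (key (Over.homMk r hr1)).1 hr2
    rw [Equiv.symm_apply_eq] at this
    exact congrArg CommaMorphism.left this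

end DependentProducts

/-! ### Hom objects and lifting problems under pullback. -/

section HomPullback

variable {𝒮 : Type u₁} [Category.{v₁} 𝒮] {𝒳 : Type u₂} [Category.{v₂} 𝒳]
  {q : 𝒳 ⥤ 𝒮} [q.IsFibered] [LocallySmallFibration q] [HasFiniteLimits 𝒮] {I : 𝒮}

/-- `hom(A, -)` preserves pullback squares. -/
lemma homMap_isPullback {A : 𝒳} (hA : q.obj A = I) {P X Y Z : 𝒳} {a : P ⟶ X} {b : P ⟶ Y}
    {c : X ⟶ Z} {d : Y ⟶ Z} (h : IsPullback a b c d) :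
    IsPullback (homMap hA a).left (homMap hA b).left (homMap hA c).left (homMap hA d).left := by
  have hw : homMap hA a ≫ homMap hA c = homMap hA b ≫ homMap hA d := by
    rw [← homMap_comp, ← homMap_comp, h.w]
  have hmap {K : Over I} {X Y : 𝒳} (g : X ⟶ Y) (t : K ⟶ homObj hA X) :
      homObjEquiv hA Y (t ≫ homMap hA g) = homObjEquiv hA X t ≫ g := by
    rw [homObjEquiv_comp, homMap, Equiv.apply_symm_apply, homObjEquiv_eq, Category.assoc]
  -- Maps from `K` into the hom objects are maps out of the reindexing of `A` along `K`, so the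
  -- universal property is that of `h`.
  have : IsPullback (homMap hA a) (homMap hA b) (homMap hA c) (homMap hA d) := by
    refine ⟨⟨hw⟩, ⟨PullbackCone.IsLimit.mk _
      (fun s => (homObjEquiv hA P).symm (h.lift (homObjEquiv hA X s.fst) (homObjEquiv hA Y s.snd)
        (by rw [← hmap, ← hmap, s.condition]))) (fun s => ?_) (fun s => ?_) (fun s t h1 h2 => ?_)⟩⟩
    · apply (homObjEquiv hA X).injective
      rw [hmap, Equiv.apply_symm_apply, h.lift_fst]
    · apply (homObjEquiv hA Y).injective
      rw [hmap, Equiv.apply_symm_apply, h.lift_snd]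
    · rw [Equiv.eq_symm_apply]
      apply h.hom_ext
      · rw [← hmap, h1, h.lift_fst]
      · rw [← hmap, h2, h.lift_snd]
  -- The forgetful functor from a slice preserves pullbacks.
  exact this.map (Over.forget I)

variable {A B : 𝒳} (hA : q.obj A = I) (hB : q.obj B = I) (m : A ⟶ B) [q.IsHomLift (𝟙 I) m]

lemma canonicalMap_fst (f : Arrow 𝒳) :
    canonicalMap hA hB m f ≫ liftingProblemsFst hA hB m f = (homPre hA hB m f.left).left :=
  pullback.lift_fst _ _ _

lemma canonicalMap_snd (f : Arrow 𝒳) :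
    canonicalMap hA hB m f ≫ liftingProblemsSnd hA hB m f = (homMap hB f.hom).left :=
  pullback.lift_snd _ _ _

lemma canonicalMap_liftingProblemsMap {f f' : Arrow 𝒳} (φ : f ⟶ f') :
    canonicalMap hA hB m f ≫ liftingProblemsMap hA hB m φ =
      (homMap hB φ.left).left ≫ canonicalMap hA hB m f' := by
  apply (liftingProblems_isPullback hA hB m f').hom_ext
  · rw [Category.assoc, liftingProblemsMap_fst, Category.assoc, canonicalMap_fst,
      ← Category.assoc, canonicalMap_fst, ← Over.comp_left, ← Over.comp_left, homPre_homMap]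
  · rw [Category.assoc, liftingProblemsMap_snd, Category.assoc, canonicalMap_snd,
      ← Category.assoc, canonicalMap_snd, ← Over.comp_left, ← Over.comp_left, ← homMap_comp,
      ← homMap_comp, Arrow.w]

/-- A pullback square `f' ⟶ f` induces a pullback square of objects of lifting problems. -/
lemma liftingProblemsMap_isPullback {f f' : Arrow 𝒳} {φ : f' ⟶ f}
    (h : IsPullback φ.left f'.hom f.hom φ.right) :
    IsPullback (liftingProblemsMap hA hB m φ) (liftingProblemsSnd hA hB m f')
      (liftingProblemsSnd hA hB m f) (homMap hB φ.right).left := by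
  -- Pasting with the defining square of `hom(m, f)` leaves an outer rectangle that, by naturality
  -- of precomposition with `m`, is the defining square of `hom(m, f')` pasted with `hom(A, -)` of
  -- `h`.
  refine IsPullback.of_right ?_ (liftingProblemsMap_snd hA hB m φ)
    (liftingProblems_isPullback hA hB m f)
  rw [liftingProblemsMap_fst, ← Over.comp_left, ← homPre_homMap, Over.comp_left]
  exact (liftingProblems_isPullback hA hB m f').paste_horiz (homMap_isPullback hA h)

/-- A pullback square `f' ⟶ f` induces a pullback square from the canonical map of `f'` to that of
`f`. -/
lemma canonicalMap_isPullback {f f' : Arrow 𝒳} {φ : f' ⟶ f}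
    (h : IsPullback φ.left f'.hom f.hom φ.right) :
    IsPullback (homMap hB φ.left).left (canonicalMap hA hB m f') (canonicalMap hA hB m f)
      (liftingProblemsMap hA hB m φ) := by
  -- Stacked on the square of lifting problems, the required square gives `hom(B, -)` of `h`.
  refine IsPullback.of_bot ?_ (canonicalMap_liftingProblemsMap hA hB m φ).symm
    (liftingProblemsMap_isPullback hA hB m h)
  rw [canonicalMap_snd, canonicalMap_snd]
  exact homMap_isPullback hB h

end HomPullback

/-! ### Vertical and cartesian maps of a fibration. -/

section Cartesian

variable {𝒮 : Type u₁} [Category.{v₁} 𝒮] {𝒞 : Type u₂} [Category.{v₂} 𝒞]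
  {𝒟 : Type u₃} [Category.{v₃} 𝒟]

lemma isHomLift_comp_iff (F : 𝒟 ⥤ 𝒞) (p : 𝒞 ⥤ 𝒮) {R S : 𝒮} (g : R ⟶ S) {a b : 𝒟} (φ : a ⟶ b) :
    (F ⋙ p).IsHomLift g φ ↔ p.IsHomLift g (F.map φ) := by
  constructor
  · intro h
    obtain ⟨⟩ := h
    exact IsHomLift.map p (F.map φ)
  · intro h
    exact IsHomLift.of_fac (F ⋙ p) g φ (IsHomLift.domain_eq p g (F.map φ))
      (IsHomLift.codomain_eq p g (F.map φ)) (IsHomLift.fac p g (F.map φ))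

/-- If `ψ` and `φ ≫ ψ` are vertical, then so is `φ`. -/
lemma isHomLift_of_comp_vertical (p : 𝒞 ⥤ 𝒮) {J : 𝒮} {a b c : 𝒞} (φ : a ⟶ b) (ψ : b ⟶ c)
    [hψ : p.IsHomLift (𝟙 J) ψ] [h : p.IsHomLift (𝟙 J) (φ ≫ ψ)] : p.IsHomLift (𝟙 J) φ := by
  have ha := IsHomLift.domain_eq p (𝟙 J) (φ ≫ ψ)
  have hb := IsHomLift.domain_eq p (𝟙 J) ψ
  refine IsHomLift.of_fac' p _ φ ha hb ?_
  have h1 := IsHomLift.fac' p (𝟙 J) (φ ≫ ψ)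
  have h2 := IsHomLift.fac' p (𝟙 J) ψ
  rw [p.map_comp, h2] at h1
  simp only [Category.id_comp, eqToHom_trans] at h1 ⊢
  rw [← cancel_mono (eqToHom (hb.trans (IsHomLift.codomain_eq p (𝟙 J) ψ).symm)), h1]
  simp

/-- Two cartesian maps over the same map with the same codomain have isomorphic domains. -/
lemma cartesian_iso {p : 𝒞 ⥤ 𝒮} {a a' b : 𝒞} (φ : a ⟶ b) (φ' : a' ⟶ b) (ha : p.obj a' = p.obj a)
    (h : p.map φ' = eqToHom ha ≫ p.map φ) (hφ : cartesian p φ) (hφ' : cartesian p φ') :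
    ∃ i : a' ≅ a, p.map i.hom = eqToHom ha ∧ i.hom ≫ φ = φ' := by
  have h1 : p.IsStronglyCartesian (p.map φ) φ := hφ
  have h2 : p.IsStronglyCartesian (p.map φ') φ' := hφ'
  have h' : p.map φ' = (eqToIso ha).hom ≫ p.map φ := h
  refine ⟨IsStronglyCartesian.domainIsoOfBaseIso p h' φ φ', ?_,
    IsStronglyCartesian.fac p (p.map φ) φ h' φ'⟩
  exact (@IsHomLift.eq_of_isHomLift _ _ _ _ p _ _ (eqToHom ha) _
    (IsStronglyCartesian.domainUniqueUpToIso_inv_isHomLift p h' φ φ')).symm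

lemma cartesian_of_iso_comp {p : 𝒞 ⥤ 𝒮} {a a' b : 𝒞} (i : a' ≅ a) (φ : a ⟶ b)
    (hφ : cartesian p φ) : cartesian p (i.hom ≫ φ) :=
  MorphismProperty.comp_mem _ _ _
    (IsStronglyCartesian.of_iso p (p.map i.hom) i) hφ

lemma exists_cartesian (p : 𝒞 ⥤ 𝒮) [p.IsFibered] {b : 𝒞} {R : 𝒮} (g : R ⟶ p.obj b) :
    ∃ (a : 𝒞) (φ : a ⟶ b) (h : p.obj a = R), p.map φ = eqToHom h ≫ g ∧ cartesian p φ := by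
  obtain ⟨a, φ, hφ⟩ := IsPreFibered.exists_isCartesian' (p := p) g
  have h := IsHomLift.domain_eq p g φ
  subst h
  obtain rfl := IsHomLift.eq_of_isHomLift p g φ
  exact ⟨a, φ, rfl, (Category.id_comp _).symm, IsFibered.isStronglyCartesian_of_isCartesian p _ φ⟩

/-- If cartesian maps into the image of `χ` lift to cartesian maps, then `χ` is a functor of
fibrations. -/
lemma isFibered_and_preservesCartesian (χ : 𝒟 ⥤ 𝒞) (p : 𝒞 ⥤ 𝒮) [p.IsFibered]
    (H : ∀ (d : 𝒟) (c : 𝒞) (ψ : c ⟶ χ.obj d), cartesian p ψ →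
      ∃ (d' : 𝒟) (φ : d' ⟶ d) (h : χ.obj d' = c),
        χ.map φ = eqToHom h ≫ ψ ∧ cartesian (χ ⋙ p) φ) :
    (χ ⋙ p).IsFibered ∧ PreservesCartesian χ p := by
  constructor
  · refine IsFibered.of_exists_isStronglyCartesian fun d R g => ?_
    obtain ⟨c, ψ, rfl, hψ, hψ'⟩ := exists_cartesian p (b := χ.obj d) g
    obtain rfl : p.map ψ = g := hψ.trans (Category.id_comp g)
    obtain ⟨d', φ, rfl, hφ, hφ'⟩ := H d c ψ hψ'
    rw [eqToHom_refl, Category.id_comp] at hφ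
    subst hφ
    exact ⟨d', φ, hφ'⟩
  · intro d d' φ hφ
    obtain ⟨c, ψ, hc, e, hψ'⟩ := exists_cartesian p (b := χ.obj d') (p.map (χ.map φ))
    obtain ⟨d'', φ', rfl, hφ', hφ''⟩ := H d' c ψ hψ'
    rw [eqToHom_refl, Category.id_comp] at hφ'
    subst hφ'
    -- The given map and the lift of a cartesian map lie over the same base map and are both
    -- cartesian, so they differ by an isomorphism of domains, which `χ` preserves.
    obtain ⟨i, -, hi⟩ := cartesian_iso φ' φ hc.symm (by
      change p.map (χ.map φ) = eqToHom _ ≫ p.map (χ.map φ')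
      rw [e, eqToHom_trans_assoc, eqToHom_refl, Category.id_comp]) hφ'' hφ
    rw [← hi, χ.map_comp]
    exact cartesian_of_iso_comp (χ.mapIso i) _ hψ'

end Cartesian

/-! ### Pullbacks of vertical maps from the codomain fibration. -/

section Vertical

variable {𝒮 : Type u₁} [Category.{v₁} 𝒮] {𝒳 : Type u₂} [Category.{v₂} 𝒳] {q : 𝒳 ⥤ 𝒮}

/-- A `cod`-cartesian square of vertical maps is a pullback square in the total category. -/
lemma Vert.isPullback {f f' : Vert q} (φ : f' ⟶ f) (hφ : cartesian (Vert.cod q) φ) :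
    IsPullback φ.hom.left f'.obj.hom f.obj.hom φ.hom.right := by
  have : (Vert.cod q).IsStronglyCartesian ((Vert.cod q).map φ) φ := hφ
  refine ⟨⟨φ.hom.w⟩, ⟨PullbackCone.isLimitAux' _ fun s => ?_⟩⟩
  -- Identities are vertical: a cone with apex `s.pt` is a square from the identity of `s.pt` to `f`
  -- over `s.snd ≫ φ.hom.right`, to which cartesianness of `φ` applies. The cone legs need not be
  -- vertical.
  let e : Vert q := ⟨Arrow.mk (𝟙 s.pt), IsHomLift.id rfl⟩
  let ψ : e ⟶ f := ObjectProperty.homMk (Arrow.homMk (u := s.fst) (v := s.snd ≫ φ.hom.right) (by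
    change s.fst ≫ f.obj.hom = 𝟙 _ ≫ s.snd ≫ φ.hom.right
    rw [Category.id_comp, s.condition]))
  let k : (Vert.cod q).obj e ⟶ (Vert.cod q).obj f' := s.snd
  have : (Vert.cod q).IsHomLift (k ≫ (Vert.cod q).map φ) ψ := IsHomLift.map (Vert.cod q) ψ
  let t := IsStronglyCartesian.map (Vert.cod q) ((Vert.cod q).map φ) φ (g := k) rfl ψ
  have ht : t ≫ φ = ψ := IsStronglyCartesian.fac _ _ _ _ _
  have htr : t.hom.right = s.snd :=
    (@IsHomLift.eq_of_isHomLift _ _ _ _ (Vert.cod q) _ _ k t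
      (IsStronglyCartesian.map_isHomLift _ _ _ _ _)).symm
  have htw : t.hom.left ≫ f'.obj.hom = s.snd := by
    rw [← htr]
    exact t.hom.w.trans (Category.id_comp _)
  refine ⟨t.hom.left, congrArg (fun x => x.hom.left) ht, htw, fun {l} h1 h2 => ?_⟩
  let t' : e ⟶ f' := ObjectProperty.homMk (Arrow.homMk (u := l) (v := s.snd)
    (h2.trans (Category.id_comp _).symm))
  have : (Vert.cod q).IsHomLift k t' := IsHomLift.map (Vert.cod q) t'
  have : t' = t := IsStronglyCartesian.map_uniq (Vert.cod q) ((Vert.cod q).map φ) φ rfl ψ t' (by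
    apply ObjectProperty.hom_ext
    apply Arrow.hom_ext
    · exact h1
    · rfl)
  rw [← this]
  rfl

/-- Vertical maps with the same codomain have a pullback, whose legs are vertical. -/
lemma exists_vertical_isPullback [(Vert.cod q).IsFibered] {J : 𝒮} {X Y Y' : 𝒳} (f : X ⟶ Y)
    (g : Y' ⟶ Y) [q.IsHomLift (𝟙 J) f] [q.IsHomLift (𝟙 J) g] :
    ∃ (X' : 𝒳) (a : X' ⟶ X) (f' : X' ⟶ Y'), q.IsHomLift (𝟙 J) a ∧ q.IsHomLift (𝟙 J) f' ∧
      IsPullback a f' f g := by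
  have hY : q.obj Y = J := IsHomLift.codomain_eq q (𝟙 J) f
  subst hY
  have hf : q.IsHomLift (𝟙 (q.obj Y)) f := inferInstance
  let F : Vert q := ⟨Arrow.mk f, hf⟩
  obtain ⟨F', φ, hY', hφ, hφ'⟩ := exists_cartesian (Vert.cod q) (b := F) g
  have h := Vert.isPullback φ hφ'
  obtain ⟨⟨X', Y'', f'⟩, hf'⟩ := F'
  change Y'' = Y' at hY'
  subst hY'
  have hr : φ.hom.right = g := hφ.trans (Category.id_comp g)
  rw [hr] at h
  have h1 : q.IsHomLift (𝟙 (q.obj Y)) f' := by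
    have e : q.obj Y'' = q.obj Y := IsHomLift.domain_eq q (𝟙 (q.obj Y)) g
    exact e ▸ hf'
  -- The remaining leg is vertical because its composite with the vertical `f` equals the vertical
  -- `f' ≫ g`.
  have h2 : q.IsHomLift (𝟙 (q.obj Y)) (φ.hom.left ≫ f) := by
    have : φ.hom.left ≫ f = f' ≫ g := h.w
    rw [this]
    infer_instance
  exact ⟨X', φ.hom.left, f', isHomLift_of_comp_vertical q φ.hom.left f, h1, h⟩

end Vertical

/-! ### Objects and squares of the fibre over `J`. -/

section Fibre

variable {𝒮 : Type u₁} [Category.{v₁} 𝒮] {𝒳 : Type u₂} [Category.{v₂} 𝒳] {q : 𝒳 ⥤ 𝒮} {J : 𝒮}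

/-- A square between vertical maps over `J`, as a square of the total category. -/
abbrev squareOf {f f' : (Vert.cod q ⋙ q).Fiber J} (φ : f ⟶ f') : arrowOf f ⟶ arrowOf f' :=
  (Fiber.fiberInclusion.map φ).hom

lemma squareOf_injective {f f' : (Vert.cod q ⋙ q).Fiber J} {φ ψ : f ⟶ f'}
    (h : squareOf φ = squareOf ψ) : φ = ψ :=
  Fiber.hom_ext (ObjectProperty.hom_ext _ h)

lemma arrowOf_isHomLift (f : (Vert.cod q ⋙ q).Fiber J) : q.IsHomLift (𝟙 J) (arrowOf f).hom := by
  obtain ⟨f, rfl⟩ := f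
  exact f.property

/-- An object of the fibre of `V(q)` over `J` from a map over `𝟙 J`. -/
def verticalMk (J : 𝒮) {X Y : 𝒳} (f : X ⟶ Y) [hf : q.IsHomLift (𝟙 J) f] :
    (Vert.cod q ⋙ q).Fiber J :=
  ⟨⟨Arrow.mk f, by
    obtain rfl : q.obj Y = J := IsHomLift.codomain_eq q (𝟙 J) f
    exact hf⟩, show q.obj Y = J from IsHomLift.codomain_eq q (𝟙 J) f⟩

/-- A map in the fibre of `V(q)` over `J` from a square. -/
def squareMk {f f' : (Vert.cod q ⋙ q).Fiber J} (φ : arrowOf f ⟶ arrowOf f')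
    (hφ : q.IsHomLift (𝟙 J) φ.right) : f ⟶ f' :=
  ⟨ObjectProperty.homMk φ, (isHomLift_comp_iff (Vert.cod q) q (𝟙 J) (ObjectProperty.homMk φ)).2 hφ⟩

end Fibre

/-! ### The codomain fibration of a fibre and its pullback squares. -/

section CodomainFibration

variable {𝒮 : Type u₁} [Category.{v₁} 𝒮] {𝒳 : Type u₂} [Category.{v₂} 𝒳] {q : 𝒳 ⥤ 𝒮} {J : 𝒮}

/-- The square underlying `φ` is a pullback square in the total category. -/
abbrev IsPullbackSquare {f f' : (Vert.cod q ⋙ q).Fiber J} (φ : f' ⟶ f) : Prop :=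
  IsPullback (squareOf φ).left (arrowOf f').hom (arrowOf f).hom (squareOf φ).right

/-- The codomain component is prescribed and the pullback supplies the domain component. Fibres of
`V(q)` are taken along `cod`, so only the codomain component must be shown vertical. -/
lemma IsPullbackSquare.existsUnique_lift {e f f' : (Vert.cod q ⋙ q).Fiber J} {φ : f' ⟶ f}
    (h : IsPullbackSquare φ) (ψ : e ⟶ f) (g : (codAt q J).obj e ⟶ (codAt q J).obj f')
    (hg : (codAt q J).map ψ = g ≫ (codAt q J).map φ) :
    ∃! t : e ⟶ f', (codAt q J).map t = g ∧ t ≫ φ = ψ := by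
  let k : (arrowOf e).right ⟶ (arrowOf f').right := g.1
  have hk : (squareOf ψ).right = k ≫ (squareOf φ).right := congrArg Subtype.val hg
  have hw : (squareOf ψ).left ≫ (arrowOf f).hom =
      ((arrowOf e).hom ≫ k) ≫ (squareOf φ).right := by
    rw [Category.assoc, ← hk]
    exact (squareOf ψ).w
  refine ⟨squareMk (Arrow.homMk (u := h.lift _ _ hw) (v := k) (h.lift_snd _ _ _)) g.2,
    ⟨rfl, squareOf_injective (Arrow.hom_ext _ _ (h.lift_fst _ _ _) hk.symm)⟩, ?_⟩
  rintro t ⟨rfl, rfl⟩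
  refine squareOf_injective (Arrow.hom_ext _ _ (h.hom_ext ?_ ?_) rfl)
  · exact (h.lift_fst _ _ _).symm
  · exact (squareOf t).w.trans (h.lift_snd _ _ _).symm

lemma IsPullbackSquare.cartesian {f f' : (Vert.cod q ⋙ q).Fiber J} {φ : f' ⟶ f}
    (h : IsPullbackSquare φ) : cartesian (codAt q J) φ := by
  refine @IsStronglyCartesian.mk _ _ _ _ _ _ _ _ _ _ _ (IsHomLift.map _ _) ?_
  intro e g ψ hψ
  obtain ⟨t, ⟨h1, h2⟩, h3⟩ := h.existsUnique_lift ψ g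
    (IsHomLift.eq_of_isHomLift (codAt q J) _ ψ).symm
  refine ⟨t, ⟨h1 ▸ IsHomLift.map (codAt q J) t, h2⟩, ?_⟩
  rintro t' ⟨h4, h5⟩
  exact h3 t' ⟨(IsHomLift.eq_of_isHomLift (codAt q J) _ t').symm, h5⟩

lemma exists_isPullbackSquare [(Vert.cod q).IsFibered] (f : (Vert.cod q ⋙ q).Fiber J)
    {Y : q.Fiber J} (g : Y ⟶ (codAt q J).obj f) :
    ∃ (f' : (Vert.cod q ⋙ q).Fiber J) (φ : f' ⟶ f) (h : (codAt q J).obj f' = Y),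
      (codAt q J).map φ = eqToHom h ≫ g ∧ IsPullbackSquare φ := by
  have h1 := arrowOf_isHomLift f
  let k : (Fiber.fiberInclusion (p := q)).obj Y ⟶ (arrowOf f).right := g.1
  have h2 : q.IsHomLift (𝟙 J) k := g.2
  obtain ⟨X', a, f', -, hf', h⟩ := exists_vertical_isPullback (q := q) (J := J) (arrowOf f).hom k
  refine ⟨verticalMk J f', squareMk (Arrow.homMk (u := a) (v := k) h.w) g.2,
    rfl, (Category.id_comp g).symm, h⟩

lemma IsPullbackSquare.of_iso_comp {f f' f'' : (Vert.cod q ⋙ q).Fiber J} (i : f' ≅ f'')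
    {φ : f'' ⟶ f} (h : IsPullbackSquare φ) : IsPullbackSquare (i.hom ≫ φ) := by
  let L : (Vert.cod q ⋙ q).Fiber J ⥤ 𝒳 :=
    Fiber.fiberInclusion ⋙ ObjectProperty.ι _ ⋙ Arrow.leftFunc
  let R : (Vert.cod q ⋙ q).Fiber J ⥤ 𝒳 :=
    Fiber.fiberInclusion ⋙ ObjectProperty.ι _ ⋙ Arrow.rightFunc
  have hl : IsIso (squareOf i.hom).left := inferInstanceAs (IsIso (L.map i.hom))
  have hr : IsIso (squareOf i.hom).right := inferInstanceAs (IsIso (R.map i.hom))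
  exact (IsPullback.of_horiz_isIso ⟨(squareOf i.hom).w⟩).paste_horiz h

instance codAt_isFibered [(Vert.cod q).IsFibered] : (codAt q J).IsFibered :=
  IsFibered.of_exists_isStronglyCartesian fun f Y g => by
    obtain ⟨f', φ, rfl, hg, h⟩ := exists_isPullbackSquare f g
    rw [eqToHom_refl, Category.id_comp] at hg
    subst hg
    exact ⟨f', φ, h.cartesian⟩

/-- A cartesian map is isomorphic to a pullback square over the same map, which exists because `cod`
is a fibration. -/
lemma cartesian_codAt_iff [(Vert.cod q).IsFibered] {f f' : (Vert.cod q ⋙ q).Fiber J} (φ : f' ⟶ f) :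
    cartesian (codAt q J) φ ↔ IsPullbackSquare φ := by
  refine ⟨fun hφ => ?_, fun h => h.cartesian⟩
  obtain ⟨f'', ψ, h, e, hψ⟩ := exists_isPullbackSquare f ((codAt q J).map φ)
  obtain ⟨i, -, rfl⟩ := cartesian_iso ψ φ h.symm (by
    rw [e, eqToHom_trans_assoc, eqToHom_refl, Category.id_comp]) hψ.cartesian hφ
  exact hψ.of_iso_comp i

lemma IsPullbackSquare.of_comp {f f' f'' : (Vert.cod q ⋙ q).Fiber J} {φ : f'' ⟶ f'} {ψ : f' ⟶ f}
    (hψ : IsPullbackSquare ψ) (h : IsPullbackSquare (φ ≫ ψ)) : IsPullbackSquare φ :=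
  IsPullback.of_right h (squareOf φ).w hψ

/-- A pullback square of vertical maps over `J` is a pullback square in the fibre. -/
lemma isPullback_fiber {Y₁ Y₂ Y₃ Y₄ : q.Fiber J} {a : Y₁ ⟶ Y₂} {b : Y₁ ⟶ Y₃}
    {c : Y₂ ⟶ Y₄} {d : Y₃ ⟶ Y₄}
    (h : IsPullback (Fiber.fiberInclusion.map a) (Fiber.fiberInclusion.map b)
      (Fiber.fiberInclusion.map c) (Fiber.fiberInclusion.map d)) : IsPullback a b c d := by
  refine ⟨⟨Fiber.hom_ext h.w⟩, ⟨PullbackCone.isLimitAux' _ fun s => ?_⟩⟩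
  have hw : Fiber.fiberInclusion.map s.fst ≫ Fiber.fiberInclusion.map c =
      Fiber.fiberInclusion.map s.snd ≫ Fiber.fiberInclusion.map d := by
    rw [← Functor.map_comp, ← Functor.map_comp, s.condition]
  -- The filler in the total category is vertical, since its composite with the vertical `a` is
  -- `s.fst`.
  have hl : q.IsHomLift (𝟙 J) (h.lift _ _ hw ≫ Fiber.fiberInclusion.map a) := by
    rw [h.lift_fst]
    infer_instance
  have ha : q.IsHomLift (𝟙 J) (Fiber.fiberInclusion.map a) := a.2
  refine ⟨⟨h.lift _ _ hw, isHomLift_of_comp_vertical q _ (Fiber.fiberInclusion.map a) (hψ := ha)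
      (h := hl)⟩,
    Fiber.hom_ext (h.lift_fst _ _ hw), Fiber.hom_ext (h.lift_snd _ _ hw), fun {k} h1 h2 => ?_⟩
  refine Fiber.hom_ext (h.hom_ext ?_ ?_)
  · exact (congrArg Subtype.val h1).trans (h.lift_fst _ _ hw).symm
  · exact (congrArg Subtype.val h2).trans (h.lift_snd _ _ hw).symm

end CodomainFibration

/-! ### A criterion for notions of structure. -/

section DiscreteFibration

variable {𝒮 : Type u₁} [Category.{v₁} 𝒮] {𝒞 : Type u₂} [Category.{v₂} 𝒞]
  {𝒟 : Type u₃} [Category.{v₃} 𝒟]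

/-- `χ` is a notion of structure if cartesian maps into its image have unique lifts, and these are
cartesian. -/
lemma isNotionOfStructure_of_existsUnique_lift (χ : 𝒟 ⥤ 𝒞) (p : 𝒞 ⥤ 𝒮) [p.IsFibered]
    (hex : ∀ (d : 𝒟) (c : 𝒞) (ψ : c ⟶ χ.obj d), cartesian p ψ →
      ∃ (d' : 𝒟) (φ : d' ⟶ d) (h : χ.obj d' = c),
        χ.map φ = eqToHom h ≫ ψ ∧ cartesian (χ ⋙ p) φ)
    (huniq : ∀ (d d₁ d₂ : 𝒟) (φ₁ : d₁ ⟶ d) (φ₂ : d₂ ⟶ d) (h : χ.obj d₁ = χ.obj d₂),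
      cartesian p (χ.map φ₁) → χ.map φ₁ = eqToHom h ≫ χ.map φ₂ →
        ∃ h' : d₁ = d₂, φ₁ = eqToHom h' ≫ φ₂) :
    IsNotionOfStructure χ p := by
  obtain ⟨hfib, hcart⟩ := isFibered_and_preservesCartesian χ p hex
  refine ⟨inferInstance, hfib, hcart, ?_⟩
  rintro ⟨d⟩
  constructor
  · rintro ⟨⟨d₁⟩, ⟨⟨⟩⟩, φ₁, hφ₁⟩ ⟨⟨d₂⟩, ⟨⟨⟩⟩, φ₂, hφ₂⟩ h
    obtain ⟨e, he⟩ : ∃ e : χ.obj d₁ = χ.obj d₂, χ.map φ₁ = eqToHom e ≫ χ.map φ₂ := by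
      -- An equality in the slice is unpacked into an equality of domains and a transported equality
      -- of maps; with both objects variable, it can be eliminated.
      have key : ∀ {x y : Over ((cartMap χ p hcart).obj ⟨d⟩)}, x = y →
          ∃ e : x.left.obj = y.left.obj, x.hom.hom = eqToHom e ≫ y.hom.hom := by
        rintro x _ rfl
        exact ⟨rfl, (Category.id_comp _).symm⟩
      exact key h
    obtain ⟨rfl, rfl⟩ := huniq d d₁ d₂ φ₁ φ₂ e (hcart _ hφ₁) he
    congr 1
    apply WideSubcategory.hom_ext
    exact Category.id_comp _
  · rintro ⟨⟨c⟩, ⟨⟨⟩⟩, ψ, hψ⟩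
    obtain ⟨d', φ, rfl, hφ, hφ'⟩ := hex d c ψ hψ
    obtain rfl : χ.map φ = ψ := hφ.trans (Category.id_comp _)
    exact ⟨Over.mk (Y := (⟨d'⟩ : Cart (χ ⋙ p))) ⟨φ, hφ'⟩, rfl⟩

end DiscreteFibration

/-! ### The lifting structures over `J` form a notion of structure. -/

section LiftingNotion

variable {𝒮 : Type u₁} [Category.{v₁} 𝒮] {𝒳 : Type u₂} [Category.{v₂} 𝒳] {q : 𝒳 ⥤ 𝒮}
  [q.IsFibered] [LocallySmallFibration q] [HasFiniteLimits 𝒮] {I J : 𝒮}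
  {A B : 𝒳} {hA : q.obj A = I} {hB : q.obj B = I} {m : A ⟶ B} [q.IsHomLift (𝟙 I) m]

local notation "χ" => liftingNotionAt hA hB m J
local notation "LS" => Functor.Fiber (liftingNotion hA hB m ⋙ Vert.cod q ⋙ q) J

/-- The section of an object of the fibre of `m^⋔` over `J`. -/
abbrev secOf (d : LS) : liftingProblems hA hB m (arrowOf ((χ).obj d)) ⟶
    (homObj hB (arrowOf ((χ).obj d)).left).left :=
  d.1.sec

lemma secOf_canonicalMap (d : LS) :
    secOf d ≫ canonicalMap hA hB m (arrowOf ((χ).obj d)) = 𝟙 _ :=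
  d.1.isSection

/-- The square `φ` commutes with the sections of `d` and `d'`. -/
abbrev CommSec {d d' : LS} (φ : (χ).obj d ⟶ (χ).obj d') : Prop :=
  secOf d ≫ (homMap hB (squareOf φ).left).left =
    liftingProblemsMap hA hB m (squareOf φ) ≫ secOf d'

lemma commSec_map {d d' : LS} (φ : d ⟶ d') : CommSec ((χ).map φ) :=
  φ.1.comm

/-- A map in the fibre of `m^⋔` from a square which commutes with the sections. -/
noncomputable def liftMk {d d' : LS} (φ : (χ).obj d ⟶ (χ).obj d') (h : CommSec φ) : d ⟶ d' :=
  ⟨⟨φ.1, h⟩, (isHomLift_comp_iff (liftingNotion hA hB m) (Vert.cod q ⋙ q) (𝟙 J)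
    (LiftingStructure.Hom.mk (d := d.1) (d' := d'.1) φ.1 h)).2 φ.2⟩

lemma map_liftMk {d d' : LS} (φ : (χ).obj d ⟶ (χ).obj d') (h : CommSec φ) :
    (χ).map (liftMk φ h) = φ := rfl

lemma liftingNotionAt_map_injective {d d' : LS} {φ ψ : d ⟶ d'} (h : (χ).map φ = (χ).map ψ) :
    φ = ψ :=
  Fiber.hom_ext (LiftingStructure.Hom.ext (congrArg Subtype.val h))

/-- For a square `ψ` into `f` whose domain carries a structure, the lift along the canonical map of
`f` of the induced map of lifting problems. -/
noncomputable abbrev secMap (d : LS) {f : (Vert.cod q ⋙ q).Fiber J} (ψ : (χ).obj d ⟶ f) :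
    liftingProblems hA hB m (arrowOf ((χ).obj d)) ⟶ (homObj hB (arrowOf f).left).left :=
  secOf d ≫ (homMap hB (squareOf ψ).left).left

lemma secMap_canonicalMap (d : LS) {f : (Vert.cod q ⋙ q).Fiber J} (ψ : (χ).obj d ⟶ f) :
    secMap d ψ ≫ canonicalMap hA hB m (arrowOf f) = liftingProblemsMap hA hB m (squareOf ψ) := by
  rw [Category.assoc, ← canonicalMap_liftingProblemsMap, ← Category.assoc, secOf_canonicalMap,
    Category.id_comp]

/-- Commutation with the sections can be tested after composition with a pullback square. -/
lemma commSec_iff_secMap {d d' : LS} {f : (Vert.cod q ⋙ q).Fiber J} {φ : (χ).obj d ⟶ f}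
    (hφ : IsPullbackSquare φ) (t : (χ).obj d' ⟶ (χ).obj d) :
    CommSec t ↔ secMap d' (t ≫ φ) = liftingProblemsMap hA hB m (squareOf t) ≫ secMap d φ := by
  have h1 : squareOf (t ≫ φ) = squareOf t ≫ squareOf φ := rfl
  rw [secMap, h1, Arrow.comp_left, homMap_comp, Over.comp_left]
  constructor
  · intro h
    rw [← Category.assoc, h, Category.assoc]
  · intro h
    -- Composites with the canonical map agree automatically, as both structures are sections; only
    -- the component in `hom(B, X)` carries information.
    apply (canonicalMap_isPullback hA hB m hφ).hom_ext
    · rw [Category.assoc, h, Category.assoc]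
    · rw [Category.assoc, Category.assoc, ← canonicalMap_liftingProblemsMap, ← Category.assoc,
        secOf_canonicalMap, secOf_canonicalMap, Category.id_comp, Category.comp_id]

lemma commSec_of_comp {d d' d'' : LS} {φ : d' ⟶ d''} (hφ : IsPullbackSquare ((χ).map φ))
    {ψ : (χ).obj d ⟶ (χ).obj d'} (h : CommSec (ψ ≫ (χ).map φ)) : CommSec ψ := by
  have h1 : squareOf (ψ ≫ (χ).map φ) = squareOf ψ ≫ squareOf ((χ).map φ) := rfl
  rw [commSec_iff_secMap hφ, secMap, h, h1, liftingProblemsMap_comp, Category.assoc, secMap,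
    commSec_map φ]

/-- The unique filler among plain squares automatically commutes with the sections, by
`commSec_of_comp`. -/
lemma cartesian_of_isPullbackSquare {d d' : LS} {φ : d ⟶ d'} (h : IsPullbackSquare ((χ).map φ)) :
    cartesian (χ ⋙ codAt q J) φ := by
  refine @IsStronglyCartesian.mk _ _ _ _ _ _ _ _ _ _ _ (IsHomLift.map _ _) ?_
  intro e g ψ hψ
  obtain ⟨t, ⟨h1, h2⟩, h3⟩ := h.existsUnique_lift ((χ).map ψ) g
    (@IsHomLift.eq_of_isHomLift _ _ _ _ (χ ⋙ codAt q J) _ _ _ ψ hψ).symm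
  have ht : CommSec t := commSec_of_comp h (by rw [h2]; exact commSec_map ψ)
  refine ⟨liftMk t ht, ⟨?_, liftingNotionAt_map_injective ?_⟩, ?_⟩
  · subst h1
    exact IsHomLift.map (χ ⋙ codAt q J) (liftMk t ht)
  · rw [Functor.map_comp, map_liftMk, h2]
  · rintro t' ⟨h4, h5⟩
    refine liftingNotionAt_map_injective (h3 _ ⟨?_, ?_⟩)
    · exact (IsHomLift.eq_of_isHomLift (χ ⋙ codAt q J) _ t').symm
    · rw [← Functor.map_comp, h5]

/-- An object of the fibre of `m^⋔` from an object of the fibre of `V(q)` and a section. -/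
noncomputable def structureMk (f : (Vert.cod q ⋙ q).Fiber J)
    (s : liftingProblems hA hB m (arrowOf f) ⟶ (homObj hB (arrowOf f).left).left)
    (hs : s ≫ canonicalMap hA hB m (arrowOf f) = 𝟙 _) : LS :=
  ⟨⟨f.1, s, hs⟩, f.2⟩

/-- The canonical map of a pullback of `f` is a pullback of that of `f`, so sections pull back.
Compatibility and the section equation fix both components of the new section, which gives strict
uniqueness. -/
lemma isNotionOfStructure_liftingNotionAt [(Vert.cod q).IsFibered] :
    IsNotionOfStructure (χ) (codAt q J) := by
  apply isNotionOfStructure_of_existsUnique_lift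
  · intro d f ψ hψ
    have h : IsPullbackSquare ψ := (cartesian_codAt_iff ψ).1 hψ
    have hw : (liftingProblemsMap hA hB m (squareOf ψ) ≫ secOf d) ≫ canonicalMap hA hB m _ =
        𝟙 _ ≫ liftingProblemsMap hA hB m (squareOf ψ) := by
      rw [Category.assoc, secOf_canonicalMap, Category.comp_id, Category.id_comp]
    have hp := canonicalMap_isPullback hA hB m h
    let d' : LS := structureMk f (hp.lift _ _ hw) (hp.lift_snd _ _ hw)
    have hc : CommSec (d := d') (d' := d) ψ := hp.lift_fst _ _ hw
    refine ⟨d', liftMk ψ hc, rfl, (Category.id_comp _).symm, cartesian_of_isPullbackSquare ?_⟩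
    exact h
  · rintro d ⟨⟨f₁, s₁, hs₁⟩, hf₁⟩ ⟨⟨f₂, s₂, hs₂⟩, hf₂⟩ φ₁ φ₂ h hφ₁ e
    obtain rfl : f₁ = f₂ := congrArg Subtype.val h
    have e' : (χ).map φ₁ = (χ).map φ₂ := e.trans (Category.id_comp _)
    have hs : s₁ = s₂ := by
      have hp := canonicalMap_isPullback hA hB m ((cartesian_codAt_iff _).1 hφ₁)
      apply hp.hom_ext
      · exact (commSec_map φ₁).trans ((congrArg (fun t => liftingProblemsMap hA hB m (squareOf t) ≫
          secOf d) e').trans ((commSec_map φ₂).symm.trans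
            (congrArg (fun t => s₂ ≫ (homMap hB (squareOf t).left).left) e'.symm)))
      · exact hs₁.trans hs₂.symm
    subst hs
    exact ⟨rfl, (liftingNotionAt_map_injective e').trans (Category.id_comp _).symm⟩

end LiftingNotion

/-! ### Pullbacks in the fibre. -/

section FibrePullbacks

variable {𝒮 : Type u₁} [Category.{v₁} 𝒮] {𝒳 : Type u₂} [Category.{v₂} 𝒳] {q : 𝒳 ⥤ 𝒮} {J : 𝒮}

lemma exists_fiber_isPullback [(Vert.cod q).IsFibered] {Y₁ Y₂ Y₃ : q.Fiber J} (c : Y₁ ⟶ Y₃)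
    (d : Y₂ ⟶ Y₃) : ∃ (P : q.Fiber J) (a : P ⟶ Y₁) (b : P ⟶ Y₂), IsPullback a b c d := by
  have hc : q.IsHomLift (𝟙 J) (Fiber.fiberInclusion.map c) := c.2
  have hd : q.IsHomLift (𝟙 J) (Fiber.fiberInclusion.map d) := d.2
  obtain ⟨P, a, b, ha, hb, h⟩ := exists_vertical_isPullback (q := q) (J := J)
    (Fiber.fiberInclusion.map c) (Fiber.fiberInclusion.map d)
  exact ⟨⟨P, IsHomLift.domain_eq q (𝟙 J) a⟩, ⟨a, ha⟩, ⟨b, hb⟩, isPullback_fiber h⟩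

end FibrePullbacks

/-! ### Representing structures by means of the right adjoint `G`. -/

section Definable

variable {𝒮 : Type u₁} [Category.{v₁} 𝒮] {𝒳 : Type u₂} [Category.{v₂} 𝒳] {q : 𝒳 ⥤ 𝒮}
  [q.IsFibered] [LocallySmallFibration q] [HasFiniteLimits 𝒮] {I J : 𝒮}
  {A B : 𝒳} {hA : q.obj A = I} {hB : q.obj B = I} {m : A ⟶ B} [q.IsHomLift (𝟙 I) m]

local notation "χ" => liftingNotionAt hA hB m J
local notation "LS" => Functor.Fiber (liftingNotion hA hB m ⋙ Vert.cod q ⋙ q) J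

/-- For a pullback square from `f'` to `f`, a lift along the canonical map of `f` of the induced map
of lifting problems gives rise to a structure on `f'`. -/
lemma exists_secMap_eq {f f' : (Vert.cod q ⋙ q).Fiber J} {φ : f' ⟶ f} (h : IsPullbackSquare φ)
    (s : liftingProblems hA hB m (arrowOf f') ⟶ (homObj hB (arrowOf f).left).left)
    (hs : s ≫ canonicalMap hA hB m (arrowOf f) = liftingProblemsMap hA hB m (squareOf φ)) :
    ∃ (d : LS) (e : (χ).obj d = f'), secMap d (eqToHom e ≫ φ) =
      liftingProblemsMap hA hB m (squareOf (eqToHom e)) ≫ s := by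
  have hp := canonicalMap_isPullback hA hB m h
  have hw : s ≫ canonicalMap hA hB m (arrowOf f) =
      𝟙 _ ≫ liftingProblemsMap hA hB m (squareOf φ) := by
    rw [hs, Category.id_comp]
  -- The equation holds by `rfl`; stating it as data lets `f'` be replaced by the image of `d`.
  refine ⟨structureMk f' (hp.lift _ _ hw) (hp.lift_snd _ _ hw), rfl, ?_⟩
  have h1 : eqToHom (rfl : f' = f') ≫ φ = φ := Category.id_comp φ
  have h2 : liftingProblemsMap hA hB m (squareOf (eqToHom (rfl : f' = f'))) = 𝟙 _ :=
    liftingProblemsMap_id hA hB m (arrowOf f')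
  change hp.lift _ _ hw ≫ (homMap hB (squareOf (eqToHom (rfl : f' = f') ≫ φ)).left).left =
    liftingProblemsMap hA hB m (squareOf (eqToHom (rfl : f' = f'))) ≫ s
  rw [h1, h2, Category.id_comp]
  exact hp.lift_fst _ _ hw

variable [LocallyCartesianClosed 𝒮] {G : Over (I ⨯ J) ⥤ q.Fiber J} (adj : homFiberFunctor hB J ⊣ G)

section Transpose

variable {f : (Vert.cod q ⋙ q).Fiber J} {Y : q.Fiber J}

/-- The map `hom(B, Y') ⟶ ∏_p hom(B, X)` which corresponds to a map from `Y'` into the image of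
the dependent product under the right adjoint of `hom(B, -)`. -/
noncomputable def transpose (k : Y ⟶ G.obj
    ((Over.map ((homFiberFunctor hB J).obj ((codAt q J).obj f)).hom).obj (depProd hA hB m f))) :
    (homObj hB (Fiber.fiberInclusion.obj Y)).left ⟶ (depProd hA hB m f).left :=
  ((adj.homEquiv _ _).symm k).left

lemma transpose_injective {k k' : Y ⟶ G.obj
    ((Over.map ((homFiberFunctor hB J).obj ((codAt q J).obj f)).hom).obj (depProd hA hB m f))}
    (h : transpose adj k = transpose adj k') : k = k' :=
  (adj.homEquiv _ _).symm.injective (Over.OverMorphism.ext h)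

lemma transpose_comp {Y' : q.Fiber J} (l : Y' ⟶ Y) (k : Y ⟶ G.obj
    ((Over.map ((homFiberFunctor hB J).obj ((codAt q J).obj f)).hom).obj (depProd hA hB m f))) :
    transpose adj (l ≫ k) =
      (homMap hB (Fiber.fiberInclusion.map l)).left ≫ transpose adj k :=
  congrArg CommaMorphism.left (adj.homEquiv_naturality_left_symm l k)

/-- Both sides of the first equation are transposes under `adj`: of `hom(B, g)`, and of the
transpose of `k` followed by the dependent product of `t_f`. -/
lemma comp_eq_iff_transpose_comp_eq (g : Y ⟶ (codAt q J).obj f) (k : Y ⟶ G.obj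
    ((Over.map ((homFiberFunctor hB J).obj ((codAt q J).obj f)).hom).obj (depProd hA hB m f))) :
    g ≫ adj.unit.app ((codAt q J).obj f) = k ≫ G.map (depProdMap hA hB m f) ↔
      transpose adj k ≫ (depProd hA hB m f).hom =
        (homMap hB (Fiber.fiberInclusion.map g)).left := by
  have h1 : g ≫ adj.unit.app ((codAt q J).obj f) =
      adj.homEquiv _ _ ((homFiberFunctor hB J).map g) := by
    rw [Adjunction.homEquiv_unit]
    exact adj.unit.naturality g
  have h2 : k ≫ G.map (depProdMap hA hB m f) =
      adj.homEquiv _ _ ((adj.homEquiv _ _).symm k ≫ depProdMap hA hB m f) := by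
    rw [Adjunction.homEquiv_naturality_right, Equiv.apply_symm_apply]
  rw [h1, h2, Equiv.apply_eq_iff_eq]
  exact ⟨fun h => (congrArg CommaMorphism.left h).symm, fun h => (Over.OverMorphism.ext h).symm⟩

/-- A map over `hom(B, Y)` is automatically one over `I ⨯ J`, because `hom(B, g)` is; hence it has a
transpose. -/
lemma exists_transpose_eq (g : Y ⟶ (codAt q J).obj f)
    (r : (homObj hB (Fiber.fiberInclusion.obj Y)).left ⟶ (depProd hA hB m f).left)
    (hr : r ≫ (depProd hA hB m f).hom = (homMap hB (Fiber.fiberInclusion.map g)).left) :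
    ∃ k : Y ⟶ G.obj ((Over.map ((homFiberFunctor hB J).obj ((codAt q J).obj f)).hom).obj
      (depProd hA hB m f)), transpose adj k = r := by
  let ρ : (homFiberFunctor hB J).obj Y ⟶
      (Over.map ((homFiberFunctor hB J).obj ((codAt q J).obj f)).hom).obj (depProd hA hB m f) :=
    Over.homMk r (by
      refine (Category.assoc _ _ _).symm.trans (Eq.trans ?_ (Over.w ((homFiberFunctor hB J).map g)))
      exact congrArg (· ≫ ((homFiberFunctor hB J).obj ((codAt q J).obj f)).hom) hr)
  exact ⟨adj.homEquiv _ _ ρ, congrArg CommaMorphism.left (Equiv.symm_apply_apply _ ρ)⟩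

end Transpose

/-- The universal pullback of `f` which carries a structure. -/
lemma exists_universal_structure [(Vert.cod q).IsFibered] (f : (Vert.cod q ⋙ q).Fiber J) :
    ∃ (d : LS) (φ : (χ).obj d ⟶ f), IsPullbackSquare φ ∧
      (∃ k, IsPullback ((codAt q J).map φ) k (adj.unit.app ((codAt q J).obj f))
        (G.map (depProdMap hA hB m f))) ∧
      ∀ (d' : LS) (ψ : (χ).obj d' ⟶ f), IsPullbackSquare ψ →
        ∃! κ : d' ⟶ d, (χ).map κ ≫ φ = ψ := by
  obtain ⟨ev, hev, huniv⟩ := exists_depProd_eval (liftingProblemsSnd hA hB m (arrowOf f))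
    (canonicalMap hA hB m (arrowOf f)) (depProd hA hB m f) rfl
  -- `D` classifies pairs consisting of a map `g` into `Y` and a structure on the pullback of `f`
  -- along `g`.
  obtain ⟨D, g, k, hD⟩ := exists_fiber_isPullback (adj.unit.app ((codAt q J).obj f))
    (G.map (depProdMap hA hB m f))
  obtain ⟨f', φ, rfl, hg, hφ⟩ := exists_isPullbackSquare f g
  obtain rfl : (codAt q J).map φ = g := hg.trans (Category.id_comp g)
  let τ : (homObj hB (arrowOf f').right).left ⟶ (depProd hA hB m f).left := transpose adj k
  have hk : τ ≫ (depProd hA hB m f).hom = (homMap hB (squareOf φ).right).left :=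
    (comp_eq_iff_transpose_comp_eq adj _ _).1 hD.w
  have hP := liftingProblemsMap_isPullback hA hB m hφ
  have hw : (liftingProblemsSnd hA hB m (arrowOf f') ≫ τ) ≫ (depProd hA hB m f).hom =
      liftingProblemsMap hA hB m (squareOf φ) ≫ liftingProblemsSnd hA hB m (arrowOf f) := by
    rw [Category.assoc, hk]
    exact hP.w.symm
  -- Following `l` by `ev` evaluates the universal `τ`: this is the lift through `t_f` that yields
  -- the structure on `f'`.
  let l := pullback.lift _ _ hw
  have hl1 : l ≫ pullback.fst _ _ = _ := pullback.lift_fst _ _ hw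
  have hl2 : l ≫ pullback.snd _ _ = _ := pullback.lift_snd _ _ hw
  obtain ⟨d, rfl, hd⟩ := exists_secMap_eq hφ (l ≫ ev) (by rw [Category.assoc, hev, hl2])
  replace hd : secMap d φ = l ≫ ev := by
    have h1 : eqToHom (rfl : (χ).obj d = (χ).obj d) ≫ φ = φ := Category.id_comp φ
    rw [h1] at hd
    rw [hd]
    exact (congrArg (· ≫ l ≫ ev) (liftingProblemsMap_id hA hB m _)).trans (Category.id_comp _)
  refine ⟨d, φ, hφ, ⟨k, hD⟩, fun d' ψ hψ => ?_⟩
  -- Conversely, the structure of `d'` is encoded by a map `r` into the dependent product, and then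
  -- by `k'`.
  obtain ⟨r, ⟨hr1, hr2⟩, hr3⟩ := huniv _ _ _ (liftingProblemsMap_isPullback hA hB m hψ)
    (secMap d' ψ) (secMap_canonicalMap d' ψ)
  obtain ⟨k', rfl⟩ := exists_transpose_eq adj ((codAt q J).map ψ) r hr1
  -- For squares over `f`, compatibility with sections amounts to compatibility with the classifying
  -- maps `k` and `k'`. The uniqueness clause `hr3` gives one direction, the evaluation equation
  -- `hr2` the other.
  have key (t : (χ).obj d' ⟶ (χ).obj d) (ht : t ≫ φ = ψ) :
      CommSec t ↔ (codAt q J).map t ≫ k = k' := by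
    have h1 : squareOf ψ = squareOf t ≫ squareOf φ := by rw [← ht]; rfl
    have e1 : (liftingProblemsMap hA hB m (squareOf t) ≫ l) ≫ pullback.fst _ _ =
        liftingProblemsSnd hA hB m (arrowOf ((χ).obj d')) ≫
          transpose adj ((codAt q J).map t ≫ k) := by
      have h2 : transpose adj ((codAt q J).map t ≫ k) =
          (homMap hB (squareOf t).right).left ≫ τ := transpose_comp adj _ k
      rw [h2, Category.assoc, hl1, ← Category.assoc, liftingProblemsMap_snd, Category.assoc]
    have e2 : (liftingProblemsMap hA hB m (squareOf t) ≫ l) ≫ pullback.snd _ _ =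
        liftingProblemsMap hA hB m (squareOf ψ) := by
      rw [Category.assoc, hl2, h1, liftingProblemsMap_comp]
    rw [commSec_iff_secMap hφ, ht, hd]
    constructor
    · intro h
      apply transpose_injective adj
      refine hr3 _ ⟨(comp_eq_iff_transpose_comp_eq adj ((codAt q J).map ψ) _).1 ?_,
        fun l' hl1' hl2' => ?_⟩
      · rw [← ht, Functor.map_comp, Category.assoc, hD.w, Category.assoc]
      · rw [h, pullback.hom_ext (hl1'.trans e1.symm) (hl2'.trans e2.symm), Category.assoc]
    · rintro rfl
      rw [← hr2 _ e1 e2, Category.assoc]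
  have hw' := (comp_eq_iff_transpose_comp_eq adj ((codAt q J).map ψ) k').2 hr1
  obtain ⟨t, ⟨ht1, ht2⟩, ht3⟩ := hφ.existsUnique_lift ψ (hD.lift _ _ hw') (hD.lift_fst _ _ hw').symm
  refine ⟨liftMk t ((key t ht2).2 (by rw [ht1, hD.lift_snd])), ht2, fun κ hκ => ?_⟩
  refine liftingNotionAt_map_injective (ht3 _ ⟨hD.hom_ext ?_ ?_, hκ⟩)
  · rw [hD.lift_fst, ← Functor.map_comp, hκ]
  · rw [hD.lift_snd, (key _ hκ).1 (commSec_map κ)]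

/-- The structures on pullbacks of `f` have a terminal object, whose underlying map is a pullback of
the image of the dependent product. -/
lemma exists_isTerminal_costructuredArrow [(Vert.cod q).IsFibered]
    (h : PreservesCartesian (χ) (codAt q J)) (f : (Vert.cod q ⋙ q).Fiber J) :
    ∃ T : CostructuredArrow (cartMap (χ) (codAt q J) h) ⟨f⟩, Nonempty (IsTerminal T) ∧
      ∃ k, IsPullback ((codAt q J).map T.hom.hom) k (adj.unit.app ((codAt q J).obj f))
        (G.map (depProdMap hA hB m f)) := by
  obtain ⟨d, φ, hφ, hk, hd⟩ := exists_universal_structure (hA := hA) (m := m) adj f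
  let T : CostructuredArrow (cartMap (χ) (codAt q J) h) ⟨f⟩ :=
    CostructuredArrow.mk (Y := (⟨d⟩ : Cart (χ ⋙ codAt q J))) ⟨φ, hφ.cartesian⟩
  have key (U : CostructuredArrow (cartMap (χ) (codAt q J) h) ⟨f⟩) :
      ∃ κ : U ⟶ T, ∀ κ' : U ⟶ T, κ' = κ := by
    have hU : IsPullbackSquare U.hom.hom := (cartesian_codAt_iff _).1 U.hom.property
    obtain ⟨κ, hκ1, hκ2⟩ := hd U.left.obj U.hom.hom hU
    -- The mediating map is itself a pullback square, by cancellation, so it lives in the category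
    -- of cartesian maps.
    have hκ : cartesian (χ ⋙ codAt q J) κ := cartesian_of_isPullbackSquare (hφ.of_comp (by
      rw [hκ1]
      exact hU))
    refine ⟨CostructuredArrow.homMk ⟨κ, hκ⟩ (WideSubcategory.hom_ext _ hκ1), fun κ' => ?_⟩
    apply CostructuredArrow.hom_ext
    apply WideSubcategory.hom_ext
    exact hκ2 _ (congrArg InducedWideCategory.Hom.hom (CostructuredArrow.w κ'))
  exact ⟨T, ⟨IsTerminal.ofUniqueHom (fun U => (key U).choose) fun U => (key U).choose_spec⟩, hk⟩

end Definable

end FibStr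

theorem mainTheorem1
    {𝒮 : Type u₁} [Category.{v₁} 𝒮] [HasFiniteLimits 𝒮] [LocallyCartesianClosed 𝒮]
    {𝒳 : Type u₂} [Category.{v₂} 𝒳] (q : 𝒳 ⥤ 𝒮) [q.IsFibered] [LocallySmallFibration q]
    [(Vert.cod q).IsFibered]
    {I J : 𝒮} {A B : 𝒳} (hA : q.obj A = I) (hB : q.obj B = I) (m : A ⟶ B)
    [q.IsHomLift (𝟙 I) m] (hJ : IsTinyRelativeTo hB J) :
    ∃ h : IsNotionOfStructure (liftingNotionAt hA hB m J) (codAt q J),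
      h.IsDefinable ∧
      ∀ (G : Over (I ⨯ J) ⥤ q.Fiber J) (adj : homFiberFunctor hB J ⊣ G)
        (R : Cart (codAt q J) ⥤ Cart (liftingNotionAt hA hB m J ⋙ codAt q J))
        (adjR : cartMap (liftingNotionAt hA hB m J) (codAt q J) h.preservesCartesian ⊣ R)
        (f : (Vert.cod q ⋙ q).Fiber J),
        ∃ k, IsPullback ((codAt q J).map (adjR.counit.app ⟨f⟩).hom) k
          (adj.unit.app ((codAt q J).obj f)) (G.map (depProdMap hA hB m f)) := by
  have h : IsNotionOfStructure (liftingNotionAt hA hB m J) (codAt q J) :=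
    isNotionOfStructure_liftingNotionAt
  refine ⟨h, ?_, fun G adj R adjR f => ?_⟩
  · have hG : (homFiberFunctor hB J).IsLeftAdjoint := hJ
    have (f : Cart (codAt q J)) : HasTerminal (CostructuredArrow (cartMap
        (liftingNotionAt hA hB m J) (codAt q J) h.preservesCartesian) f) := by
      obtain ⟨T, ⟨hT⟩, -⟩ := exists_isTerminal_costructuredArrow
        (Adjunction.ofIsLeftAdjoint (homFiberFunctor hB J)) h.preservesCartesian f.obj
      exact hT.hasTerminal
    exact isLeftAdjoint_of_costructuredArrowTerminals _
  · obtain ⟨T, ⟨hT⟩, k, hk⟩ := exists_isTerminal_costructuredArrow adj h.preservesCartesian f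
    -- The counit of any right adjoint is terminal among arrows into `f`; this isomorphism, applied
    -- to codomains through `P`, carries the pullback square across.
    let i := (mkTerminalOfRightAdjoint _ adjR ⟨f⟩).uniqueUpToIso hT
    let P : CostructuredArrow (cartMap (liftingNotionAt hA hB m J) (codAt q J)
        h.preservesCartesian) ⟨f⟩ ⥤ q.Fiber J :=
      CostructuredArrow.proj _ _ ⋙
        cartMap (liftingNotionAt hA hB m J) (codAt q J) h.preservesCartesian ⋙
          wideSubcategoryInclusion _ ⋙ codAt q J
    have hw : (P.mapIso i).hom ≫ (codAt q J).map T.hom.hom =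
        (codAt q J).map (adjR.counit.app ⟨f⟩).hom := by
      have := congrArg InducedWideCategory.Hom.hom (CostructuredArrow.w i.hom)
      exact ((codAt q J).map_comp _ _).symm.trans (congrArg (codAt q J).map this)
    refine ⟨(P.mapIso i).hom ≫ k, hk.of_iso (P.mapIso i).symm (Iso.refl _) (Iso.refl _)
      (Iso.refl _) ?_ ?_ ?_ ?_⟩
    · rw [← hw]
      exact (Category.comp_id _).trans ((P.mapIso i).inv_hom_id_assoc _).symm
    · exact (Category.comp_id _).trans ((P.mapIso i).inv_hom_id_assoc _).symm
    · simp
    · simp
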